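/- Let $\mathbb F$ be a field (of any characteristic, not necessarily algebraically closed), let $0\le k\le n$, and let $e_1<e_2<\cdots<e_k$ be integers (possibly negative). For $\alpha=(\alpha_1,\dots,\alpha_n)$ with entries in a field, let $$V=V(\alpha)=\begin{pmatrix}\alpha_1^{e_1}&\cdots&\alpha_n^{e_1}\\ \vdots&\ddots&\vdots\\ \alpha_1^{e_k}&\cdots&\alpha_n^{e_k}\end{pmatrix}.$$ Definitions. For a matrix $G$ with $n$ columns and $A\subseteq[n]$, let $G_A$ be the span of the columns of $G$ indexed by $A$. An $m\times n$ matrix $G$ over a field $\mathbb K$ is $(n,m)$-$\mathrm{MDS}(\ell)$ if for all $A_1,\dots,A_\ell\subseteq[n]$ one has $\dim(G_{A_1}\cap\cdots\cap G_{A_\ell})=\dim(W_{A_1}\cap\cdots\cap W_{A_\ell})$, where $W$ is the generic $m\times n$ matrix, whose entries are independent transcendental variables over $\mathbb K$. If $V\in\mathbb K^{k\times n}$ has rank $k$, a dual matrix $Q\in V^\perp$ is a matrix $Q\in\mathbb K^{(n-k)\times n}$ of rank $n-k$ with $VQ^{T}=0$. A linear code $C\subseteq\mathbb K^n$ is $(\rho,m)$-average-radius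 list-decodable if there are no $m+1$ distinct codewords $c_0,\dots,c_m\in C$ and $y\in\mathbb K^n$ with $\frac1{m+1}\sum_{i}\mathrm{wt}(c_i-y)\le\rho n$, where $\mathrm{wt}$ is the Hamming weight. $C$ is $\mathrm{LD\text{-}MDS}(\le L)$ if for every $1\le m\le L$ it is $(\rho,m)$-average-radius list-decodable with $\rho=\frac{m}{m+1}\cdot\frac{n-\dim C}{n}$. A matrix is called $\mathrm{LD\text{-}MDS}(\le L)$ if the code spanned by its rows is. Theorem. Suppose $\alpha_1,\dots,\alpha_n$ are generic. Then $V$ has rank $k$, and for all $L\ge 2$, $V$ is $\mathrm{LD\text{-}MDS}(\le L)$, and every dual matrix $Q\in V^\perp$ is $(n,n-k)$-$\mathrm{MDS}(L+1)$. Here "generic" may be read in either of two ways, and the theorem holds for both: (i) $\alpha_1,\dots,\alpha_n$ are elements of any extension field $\mathbb K$ of $\mathbb F$ that are algebraically independent over $\mathbb F$; (ii) $\alpha\in\mathbb F^n$ lies outside a proper hypersurface: there is a nonzero polynomial $P\in\mathbb F[x_1,\dots,x_n]$, depending only on $\mathbb F$, $n$, $k$ and the $e_i$ (not on $L$), such that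 the conclusions hold for every $\alpha\in\mathbb F^n$ with $P(\alpha)\ne0$ (for an algebraically closed, or just infinite, $\mathbb F$ such points exist). -/

import Mathlib

namespace HigherOrderMDS

/-- The column span `G_A` of the columns of `G` indexed by `A`. -/
def colSpan {F : Type*} [Field F] {k n : ℕ} (G : Matrix (Fin k) (Fin n) F)
    (A : Finset (Fin n)) : Submodule F (Fin k → F) :=
  Submodule.span F ((fun j : Fin n => fun i : Fin k => G i j) '' (A : Set (Fin n)))

/-- The generic `k × n` matrix over `F`: its entries are `k * n` independent transcendental
variables, in the rational function field `F(w_{i,j})`. -/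
noncomputable def genericMatrix (F : Type*) [Field F] (k n : ℕ) :
    Matrix (Fin k) (Fin n) (FractionRing (MvPolynomial (Fin k × Fin n) F)) :=
  Matrix.of fun i j => algebraMap (MvPolynomial (Fin k × Fin n) F)
    (FractionRing (MvPolynomial (Fin k × Fin n) F)) (MvPolynomial.X (i, j))

/-- `G` is (the generator matrix of) an `(n,k)`-`MDS(ℓ)` code: every `ℓ`-fold intersection of
column spans has the same dimension as it has for the generic matrix. -/
def IsMDS {F : Type*} [Field F] {k n : ℕ} (ℓ : ℕ) (G : Matrix (Fin k) (Fin n) F) : Prop :=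
  ∀ A : Fin ℓ → Finset (Fin n),
    Module.finrank F (⨅ i, colSpan G (A i) : Submodule F (Fin k → F)) =
      Module.finrank (FractionRing (MvPolynomial (Fin k × Fin n) F))
        (⨅ i, colSpan (genericMatrix F k n) (A i) :
          Submodule (FractionRing (MvPolynomial (Fin k × Fin n) F))
            (Fin k → FractionRing (MvPolynomial (Fin k × Fin n) F)))

/-- `Q` is a dual matrix of the `k × n` matrix `V` (of rank `k`): it is an `(n-k) × n` matrix
of rank `n-k` whose rows are orthogonal to those of `V`. -/
def IsDualMatrix {F : Type*} [Field F] {k n : ℕ} (V : Matrix (Fin k) (Fin n) F)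
    (Q : Matrix (Fin (n - k)) (Fin n) F) : Prop :=
  Q.rank = n - k ∧ ∀ (i : Fin k) (j : Fin (n - k)), ∑ t, V i t * Q j t = 0

/-- The linear code generated by the rows of `V`. -/
def rowCode {F : Type*} [Field F] {k n : ℕ} (V : Matrix (Fin k) (Fin n) F) :
    Submodule F (Fin n → F) :=
  Submodule.span F (Set.range fun i : Fin k => fun j : Fin n => V i j)

open scoped Classical in
/-- `C` is `(ρ, L)`-average-radius list-decodable: there are no `L + 1` (pairwise distinct)
codewords whose average Hamming distance to some `y` is at most `ρ n`. -/
def IsAvgRadiusListDecodable {F : Type*} [Field F] {n : ℕ} (ρ : ℝ) (L : ℕ)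
    (C : Submodule F (Fin n → F)) : Prop :=
  ¬ ∃ (c : Fin (L + 1) → Fin n → F) (y : Fin n → F),
      Function.Injective c ∧ (∀ i, c i ∈ C) ∧
        1 / ((L : ℝ) + 1) * ∑ i, (hammingNorm (c i - y) : ℝ) ≤ ρ * n

/-- `C` is `LD-MDS(≤ L)`: for every list size `m ≤ L` it is average-radius list-decodable up to
the generalized Singleton bound `ρ = m / (m + 1) * (n - dim C) / n`. -/
def IsLDMDS {F : Type*} [Field F] {n : ℕ} (L : ℕ) (C : Submodule F (Fin n → F)) : Prop :=
  ∀ m : ℕ, 1 ≤ m → m ≤ L →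
    IsAvgRadiusListDecodable
      ((m : ℝ) / ((m : ℝ) + 1) * (((n : ℝ) - (Module.finrank F C : ℝ)) / (n : ℝ))) m C

/-- The monomial matrix `(α_j ^ {e_i})_{i,j}`. -/
def monomialMatrix {F : Type*} [Field F] {k n : ℕ} (e : Fin k → ℤ) (α : Fin n → F) :
    Matrix (Fin k) (Fin n) F :=
  Matrix.of fun i j => α j ^ e i

end HigherOrderMDS

/-!
The columns of the monomial matrix `V` are the vectors `(α_j ^ {e_i})_i`, so a codeword is given by
a coefficient vector `x : Fin k → F`, with `j`-th coordinate `∑ i, α_j ^ {e_i} x i`. Both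
conclusions are statements about families of codewords `(x_v)_{v ∈ T}` in which, for every
coordinate `j`, the members indexed by a set `e j ⊆ T` agree at `j`; such families form the space
`agreeSpace`. If every nonempty `I ⊆ T` satisfies `∑ j, (#(e j ∩ I) - 1) ≤ k (#I - 1)` ("sparsity"),
one expects the agreement conditions to be independent, and this is the property
`InGeneralPosition` on which everything rests.

**Monomial points are in general position.** One proves a stronger statement with vertex weights
`a v`, in which the top `a v` coefficients of `x_v` are moreover identified with those of the other
vertices having them in their range (`finrank_agreeSpace_add_le_of_degeneration`). The induction has
three moves. If the sparsity inequality is an equality for some `I ⊂ T` with at least two elements,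
then the family is constant on `I`, and `I` is contracted to a point. Otherwise let `v` have maximal
weight. If `v` lies on a nontrivial edge `e n`, let `α_n` tend to infinity: since the exponents are
distinct, in the limit the condition at `n` is a condition on the leading coefficients, and the
edge is absorbed by adding one to the weights of its vertices; sparsity survives because the
inequality was strict on proper subsets, and on `T` because the maximal weight increases. If `v` is
on no nontrivial edge, it is deleted. The passage to the limit is made in Laurent series over the
field of rational functions in the `α_j` (`finrank_agreeSpace_laurent_le`), and is carried back to
the generic point, and later to all points off a hypersurface, by semicontinuity of the rank
(`exists_ne_zero_finrank_solutionSpace_le`). There are finitely many hypergraphs on the vertex set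
`Finset (Fin n)`, so a single polynomial serves them all, and hence serves all list sizes.

**From sparse to arbitrary hypergraphs.** A maximal sparse subhypergraph has, by supermodularity, a
partition of `T` into maximal tight sets; this partition computes the dimension of the space of
agreeing families of the original hypergraph (`InGeneralPosition.exists_blocks`).

**Consequences.** Codewords violating the generalized Singleton bound agree with the received word
on large sets; taking these sets as vertices, the partition must be discrete, and the dimension
count forces all the codewords to coincide (`InGeneralPosition.card_le_one_of_agree`). For a dual
matrix `Q`, the intersection of the spans `Q_A` has, up to known terms, the dimension of the space
of families `(y_A)` with `y_A` supported on `A` and `Q y_A` independent of `A`; differences of such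
vectors are codewords, so this is again an agreement space
(`IsDualMatrix.finrank_coincidenceSpace_add_le`). The partition bound shows that the intersection is
at most as large as it must be for any matrix with the same column-span dimensions
(`sum_card_blockInter_le`), in particular for the generic matrix, and semicontinuity gives the
opposite inequality.
-/

namespace HigherOrderMDS
open Module

/-! ### Systems of linear equations under specialization -/

/-- The solutions over `Ω` of the system of linear equations whose coefficient vectors are the
images under `φ` of the elements of `E`. -/
def solutionSpace {R Ω c : Type*} [CommRing R] [Field Ω] [Fintype c] (φ : R →+* Ω)
    (E : Set (c → R)) : Submodule Ω (c → Ω) where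
  carrier := {x | ∀ m ∈ E, ∑ i, φ (m i) * x i = 0}
  add_mem' {x y} hx hy m hm := by
    simp only [Pi.add_apply, mul_add, Finset.sum_add_distrib, hx m hm, hy m hm, add_zero]
  zero_mem' m _ := by simp
  smul_mem' t x hx m hm := by
    have := hx m hm
    simp only [Pi.smul_apply, smul_eq_mul, mul_left_comm _ t, ← Finset.mul_sum, this, mul_zero]

theorem mem_solutionSpace {R Ω c : Type*} [CommRing R] [Field Ω] [Fintype c] {φ : R →+* Ω}
    {E : Set (c → R)} {x : c → Ω} :
    x ∈ solutionSpace φ E ↔ ∀ m ∈ E, ∑ i, φ (m i) * x i = 0 := Iff.rfl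

section LinearForms
variable {R Ω c γ : Type*} [CommRing R] [Field Ω] [Fintype c] [DecidableEq c] [Fintype γ]
  (φ : R →+* Ω) (f : c → Ω)

theorem sum_map_single_mul (q : c) : ∑ p, φ ((Pi.single q 1 : c → R) p) * f p = f q := by
  rw [Finset.sum_eq_single q]
  · simp
  · intro p _ hp; simp [Pi.single_eq_of_ne hp]
  · simp

theorem sum_map_single_sub_single_mul (q q' : c) :
    ∑ p, φ ((Pi.single q 1 - Pi.single q' 1 : c → R) p) * f p = f q - f q' := by
  simp only [Pi.sub_apply, map_sub, sub_mul, Finset.sum_sub_distrib, sum_map_single_mul]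

theorem sum_map_sum_smul_single_sub_single_mul (t : γ → R) (q q' : γ → c) :
    ∑ p, φ ((∑ i, t i • (Pi.single (q i) 1 - Pi.single (q' i) 1) : c → R) p) * f p =
      ∑ i, φ (t i) * f (q i) - ∑ i, φ (t i) * f (q' i) := by
  simp only [Finset.sum_apply, map_sum, Finset.sum_mul]
  rw [Finset.sum_comm, ← Finset.sum_sub_distrib]
  refine Finset.sum_congr rfl fun i _ => ?_
  rw [← mul_sub, ← sum_map_single_sub_single_mul φ, Finset.mul_sum]
  refine Finset.sum_congr rfl fun p _ => ?_
  rw [Pi.smul_apply, smul_eq_mul, map_mul, mul_assoc]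

end LinearForms

/-- The rank of the specialized system is witnessed by a minor with entries in `R`. -/
theorem exists_minor_ne_zero {R Ω c : Type*} [CommRing R] [Field Ω] [Fintype c] (φ : R →+* Ω)
    (E : Set (c → R)) : ∃ (r : ℕ) (m : Fin r → c → R) (g : Fin r → c),
      (∀ i, m i ∈ E) ∧ finrank Ω (solutionSpace φ E) + r = Fintype.card c ∧
      φ (Matrix.det (Matrix.of fun i j => m i (g j))) ≠ 0 := by
  classical
  obtain ⟨r, -, f, hfE, hspan, hli⟩ : ∃ r : ℕ,
      r = finrank Ω (Submodule.span Ω ((fun m : c → R => φ ∘ m) '' E)) ∧ ∃ f : Fin r → (c → Ω),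
      (∀ i, f i ∈ (fun m : c → R => φ ∘ m) '' E) ∧ Submodule.span Ω (Set.range f) =
        Submodule.span Ω ((fun m : c → R => φ ∘ m) '' E) ∧ LinearIndependent Ω f :=
    ⟨_, rfl, Submodule.exists_fun_fin_finrank_span_eq Ω _⟩
  choose m hmE hm using hfE
  let A : Matrix (Fin r) c Ω := Matrix.of f
  have hA : A.rank = r := by
    have := LinearIndependent.rank_matrix (M := A) (show LinearIndependent Ω A.row from hli)
    simpa using this
  have hsol : solutionSpace φ E = LinearMap.ker A.mulVecLin := by
    ext x
    rw [mem_solutionSpace, LinearMap.mem_ker]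
    constructor
    · intro h
      ext i
      have := h (m i) (hmE i)
      simp only [Matrix.mulVecLin_apply, Matrix.mulVec, dotProduct, A, Matrix.of_apply,
        Pi.zero_apply]
      rw [← hm i]
      exact this
    · intro h m' hm'
      have key : Submodule.span Ω ((fun m : c → R => φ ∘ m) '' E) ≤
          LinearMap.ker ((dotProductBilin Ω Ω).flip x : (c → Ω) →ₗ[Ω] Ω) := by
        rw [← hspan, Submodule.span_le]
        rintro _ ⟨i, rfl⟩
        have := congrFun h i
        change f i ⬝ᵥ x = 0
        simpa [Matrix.mulVec, A] using this
      have := key (Submodule.subset_span ⟨m', hm', rfl⟩)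
      simpa [dotProduct] using this
  have hcol : finrank Ω (Submodule.span Ω (Set.range A.col)) = r := by
    rw [← Matrix.rank_eq_finrank_span_cols, hA]
  obtain ⟨g', hg', -, hgli⟩ : ∃ f : Fin r → (Fin r → Ω), (∀ i, f i ∈ Set.range A.col) ∧
      Submodule.span Ω (Set.range f) = Submodule.span Ω (Set.range A.col) ∧
      LinearIndependent Ω f := by
    have := Submodule.exists_fun_fin_finrank_span_eq Ω (Set.range A.col)
    rwa [hcol] at this
  choose g hg using hg'
  refine ⟨r, m, g, hmE, ?_, ?_⟩
  · have := LinearMap.finrank_range_add_finrank_ker A.mulVecLin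
    rw [hsol, add_comm]
    change A.rank + _ = _ at this
    rw [hA] at this
    simpa using this
  · have hdet : IsUnit (Matrix.of fun i j => φ (m i (g j))) := by
      rw [← Matrix.linearIndependent_cols_iff_isUnit]
      convert hgli using 1
      ext j i
      rw [← hg j]
      change φ (m i (g j)) = f i (g j)
      exact congrFun (hm i) (g j)
    rw [Matrix.isUnit_iff_isUnit_det, isUnit_iff_ne_zero] at hdet
    rw [RingHom.map_det]
    exact hdet

/-- A minor that does not vanish under `φ` bounds the dimension of the solution space. -/
theorem finrank_solutionSpace_add_le {R Ω c : Type*} [CommRing R] [Field Ω] [Fintype c]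
    (φ : R →+* Ω) (E : Set (c → R)) {r : ℕ} (m : Fin r → c → R) (g : Fin r → c)
    (hm : ∀ i, m i ∈ E) (h : φ (Matrix.det (Matrix.of fun i j => m i (g j))) ≠ 0) :
    finrank Ω (solutionSpace φ E) + r ≤ Fintype.card c := by
  classical
  let A : Matrix (Fin r) c Ω := Matrix.of fun i j => φ (m i j)
  have hle : solutionSpace φ E ≤ LinearMap.ker A.mulVecLin := by
    intro x hx
    rw [LinearMap.mem_ker]
    ext i
    simpa [A, Matrix.mulVec, dotProduct] using hx (m i) (hm i)
  have hA : r ≤ A.rank := by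
    have h1 : (A.submatrix id g).rank = r := by
      rw [Matrix.rank_of_isUnit]
      · simp
      · rw [Matrix.isUnit_iff_isUnit_det, isUnit_iff_ne_zero]
        rw [RingHom.map_det] at h
        exact h
    exact h1.symm.trans_le <| Matrix.rank_submatrix_le A id g
  have h1 := LinearMap.finrank_range_add_finrank_ker A.mulVecLin
  have h2 := Submodule.finrank_mono hle
  change A.rank + _ = _ at h1
  simp only [finrank_fintype_fun_eq_card] at h1
  omega

/-- Semicontinuity: the solution space does not grow when passing from the specialization `φ` to
any specialization `ψ` off the zero set of some `P` with `φ P ≠ 0`. -/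
theorem exists_ne_zero_finrank_solutionSpace_le {R Ω c : Type*} [CommRing R] [Field Ω] [Fintype c]
    (φ : R →+* Ω) (E : Set (c → R)) :
    ∃ P : R, φ P ≠ 0 ∧ ∀ {L : Type*} [Field L] (ψ : R →+* L), ψ P ≠ 0 →
      finrank L (solutionSpace ψ E) ≤ finrank Ω (solutionSpace φ E) := by
  obtain ⟨r, m, g, hm, hr, hP⟩ := exists_minor_ne_zero φ E
  refine ⟨_, hP, fun ψ hψ => ?_⟩
  have := finrank_solutionSpace_add_le ψ E m g hm hψ
  omega

/-- If the constant terms of all integral vectors of `S` lie in `S₀`, then `S₀` is at least as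
large as `S`. -/
theorem finrank_le_of_coeff_zero_mem {Ω c : Type*} [Field Ω] [Fintype c]
    (S : Submodule (LaurentSeries Ω) (c → LaurentSeries Ω)) (S₀ : Submodule Ω (c → Ω))
    (h : ∀ s ∈ S, (∀ i, ∀ n < 0, (s i).coeff n = 0) → (fun i => (s i).coeff 0) ∈ S₀) :
    finrank (LaurentSeries Ω) S ≤ finrank Ω S₀ := by
  classical
  induction hd : finrank (LaurentSeries Ω) S generalizing S S₀ with
  | zero => exact Nat.zero_le _
  | succ d ih =>
    have hS : S ≠ ⊥ := by
      rintro rfl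
      simp at hd
    obtain ⟨s, hsS, hs0⟩ := Submodule.exists_mem_ne_zero_of_ne_bot hS
    obtain ⟨i₀, hi₀⟩ : ∃ i, s i ≠ 0 := by
      by_contra! hcon
      exact hs0 (funext hcon)
    obtain ⟨j, hj, hmin⟩ := Finset.exists_min_image (Finset.univ.filter fun i => s i ≠ 0)
      (fun i => (s i).order) ⟨i₀, by simpa using hi₀⟩
    simp only [Finset.mem_filter, Finset.mem_univ, true_and] at hj hmin
    -- normalize a vector at a coordinate of least order: it becomes integral, with value `1` there
    set t : c → LaurentSeries Ω := (s j)⁻¹ • s with ht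
    have htS : t ∈ S := S.smul_mem _ hsS
    have htj : t j = 1 := by simp [ht, hj]
    have htint : ∀ i, ∀ n < 0, (t i).coeff n = 0 := by
      intro i n hn
      by_cases hi : s i = 0
      · simp [ht, hi]
      · have h1 : s i = t i * s j := by simp [ht, hj, mul_comm]
        have hti : t i ≠ 0 := by
          intro h0; rw [h0, zero_mul] at h1; exact hi h1
        have h2 := HahnSeries.order_mul hti hj
        rw [← h1] at h2
        have h3 := hmin i hi
        apply HahnSeries.coeff_eq_zero_of_lt_order
        omega
    have key := ih (S ⊓ LinearMap.ker (LinearMap.proj j)) (S₀ ⊓ LinearMap.ker (LinearMap.proj j))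
      (by
        rintro x ⟨hxS, hxj⟩ hx
        refine ⟨h x hxS hx, ?_⟩
        have : x j = 0 := hxj
        simp [this])
      (by
        have e1 := LinearMap.finrank_range_add_finrank_ker
          ((LinearMap.proj j : (c → LaurentSeries Ω) →ₗ[LaurentSeries Ω] _).domRestrict S)
        have e2 : LinearMap.range ((LinearMap.proj j :
            (c → LaurentSeries Ω) →ₗ[LaurentSeries Ω] _).domRestrict S) = ⊤ := by
          rw [LinearMap.range_eq_top]
          intro y
          refine ⟨⟨y • t, S.smul_mem _ htS⟩, ?_⟩
          simp [htj]
        rw [e2, finrank_top, finrank_self, hd] at e1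
        have e3 : finrank (LaurentSeries Ω) (LinearMap.ker ((LinearMap.proj j :
            (c → LaurentSeries Ω) →ₗ[LaurentSeries Ω] _).domRestrict S)) =
            finrank (LaurentSeries Ω) (S ⊓ LinearMap.ker (LinearMap.proj j) :
              Submodule (LaurentSeries Ω) (c → LaurentSeries Ω)) := by
          rw [LinearMap.ker_domRestrict]
          exact (Submodule.equivSubtypeMap _ _).finrank_eq.trans
            (by rw [Submodule.map_comap_subtype])
        omega)
    have hlt : S₀ ⊓ LinearMap.ker (LinearMap.proj j) < S₀ := by
      refine lt_of_le_of_ne inf_le_left fun heq => ?_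
      have h1 := h t htS htint
      rw [← heq] at h1
      have h2 : (t j).coeff 0 = 0 := h1.2
      rw [htj] at h2
      simp at h2
    have := Submodule.finrank_lt_finrank_of_lt hlt
    omega

/-! ### Families of codewords agreeing along a hypergraph -/

section Defs
variable {τ ι : Type*} {k : ℕ}

/-- Families `(f (v, ·))_{v ∈ T}` of coefficient vectors, extended by zero outside `T`, such that
the codewords of the members of `e j` agree in coordinate `j`, and such that the vectors of `u`
and `v` agree in each position `i` that is among the top `a u` positions and among the top `a v`
positions, that is, with `k - a u ≤ i` and `k - a v ≤ i`. -/
def agreeSpace {Ω : Type*} [Field Ω] (V : Matrix (Fin k) ι Ω) (T : Finset τ)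
    (e : ι → Finset τ) (a : τ → ℕ) : Submodule Ω (τ × Fin k → Ω) where
  carrier := {f | (∀ v i, v ∉ T → f (v, i) = 0) ∧
    (∀ j, ∀ u ∈ T, ∀ v ∈ T, u ∈ e j → v ∈ e j →
      ∑ i, V i j * f (u, i) = ∑ i, V i j * f (v, i)) ∧
    ∀ i : Fin k, ∀ u ∈ T, ∀ v ∈ T, k ≤ a u + i → k ≤ a v + i → f (u, i) = f (v, i)}
  add_mem' := by
    rintro f g ⟨h1, h2, h3⟩ ⟨h1', h2', h3'⟩
    refine ⟨fun v i hv => ?_, fun j u hu v hv hue hve => ?_, fun i u hu v hv h h' => ?_⟩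
    · simp [h1 v i hv, h1' v i hv]
    · simp only [Pi.add_apply, mul_add, Finset.sum_add_distrib, h2 j u hu v hv hue hve,
        h2' j u hu v hv hue hve]
    · simp only [Pi.add_apply, h3 i u hu v hv h h', h3' i u hu v hv h h']
  zero_mem' := by simp
  smul_mem' := by
    rintro t f ⟨h1, h2, h3⟩
    refine ⟨fun v i hv => ?_, fun j u hu v hv hue hve => ?_, fun i u hu v hv h h' => ?_⟩
    · simp [h1 v i hv]
    · simp only [Pi.smul_apply, smul_eq_mul, mul_left_comm _ t, ← Finset.mul_sum,
        h2 j u hu v hv hue hve]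
    · simp only [Pi.smul_apply, h3 i u hu v hv h h']

theorem mem_agreeSpace {Ω : Type*} [Field Ω] {V : Matrix (Fin k) ι Ω} {T : Finset τ}
    {e : ι → Finset τ} {a : τ → ℕ} {f : τ × Fin k → Ω} :
    f ∈ agreeSpace V T e a ↔ (∀ v i, v ∉ T → f (v, i) = 0) ∧
      (∀ j, ∀ u ∈ T, ∀ v ∈ T, u ∈ e j → v ∈ e j →
        ∑ i, V i j * f (u, i) = ∑ i, V i j * f (v, i)) ∧
      ∀ i : Fin k, ∀ u ∈ T, ∀ v ∈ T, k ≤ a u + i → k ≤ a v + i → f (u, i) = f (v, i) := Iff.rfl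

/-- The linear forms that cut out `agreeSpace`, over a ring that can be specialized. -/
def agreeForms [DecidableEq τ] {R : Type*} [CommRing R] (V : Matrix (Fin k) ι R) (T : Finset τ)
    (e : ι → Finset τ) (a : τ → ℕ) : Set (τ × Fin k → R) :=
  {m | ∃ v i, v ∉ T ∧ m = Pi.single (v, i) 1} ∪
  {m | ∃ j, ∃ u ∈ T, ∃ v ∈ T, u ∈ e j ∧ v ∈ e j ∧
    m = ∑ i, V i j • (Pi.single (u, i) 1 - Pi.single (v, i) 1)} ∪
  {m | ∃ i : Fin k, ∃ u ∈ T, ∃ v ∈ T, k ≤ a u + i ∧ k ≤ a v + i ∧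
    m = Pi.single (u, i) 1 - Pi.single (v, i) 1}

theorem solutionSpace_agreeForms [DecidableEq τ] [Fintype τ] {R Ω : Type*} [CommRing R]
    [Field Ω] (φ : R →+* Ω) (V : Matrix (Fin k) ι R) (T : Finset τ) (e : ι → Finset τ) (a : τ → ℕ) :
    solutionSpace φ (agreeForms V T e a) = agreeSpace (V.map φ) T e a := by
  have hs := sum_map_single_mul (c := τ × Fin k) φ
  have hd := sum_map_single_sub_single_mul (c := τ × Fin k) φ
  have he : ∀ (f : τ × Fin k → Ω) (j : ι) (u v : τ),
      ∑ p, φ ((∑ i, V i j • (Pi.single (u, i) 1 - Pi.single (v, i) 1) : τ × Fin k → R) p) * f p =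
        ∑ i, φ (V i j) * f (u, i) - ∑ i, φ (V i j) * f (v, i) := fun f j u v =>
    sum_map_sum_smul_single_sub_single_mul φ f _ _ _
  ext f
  rw [mem_solutionSpace, mem_agreeSpace]
  constructor
  · intro h
    refine ⟨fun v i hv => ?_, fun j u hu v hv hue hve => ?_, fun i u hu v hv h1 h2 => ?_⟩
    · rw [← hs f (v, i)]; exact h _ (Or.inl (Or.inl ⟨v, i, hv, rfl⟩))
    · rw [← sub_eq_zero]
      exact (he f j u v).symm.trans (h _ (Or.inl (Or.inr ⟨j, u, hu, v, hv, hue, hve, rfl⟩)))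
    · rw [← sub_eq_zero, ← hd]; exact h _ (Or.inr ⟨i, u, hu, v, hv, h1, h2, rfl⟩)
  · rintro ⟨h1, h2, h3⟩ m ((⟨v, i, hv, rfl⟩ | ⟨j, u, hu, v, hv, hue, hve, rfl⟩) |
      ⟨i, u, hu, v, hv, h4, h5, rfl⟩)
    · rw [hs, h1 v i hv]
    · rw [he, sub_eq_zero]; exact h2 j u hu v hv hue hve
    · rw [hd, h3 i u hu v hv h4 h5, sub_self]

/-- The expected number of independent agreement conditions, per coefficient vector, that the
hypergraph `e` imposes on the vertices in `I`; the subtraction is truncated, as an edge not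
meeting `I` imposes none. -/
def excess [DecidableEq τ] [Fintype ι] (e : ι → Finset τ) (I : Finset τ) : ℕ :=
  ∑ j, ((e j ∩ I).card - 1)

/-- No subset `I` of `T` carries more conditions than the `k * (#I - 1)` that families constant
on `I` allow. The conditions due to the weights number `∑ v ∈ I, a v - I.sup a`; the inequality is
arranged to avoid subtraction. -/
def IsSparse [DecidableEq τ] [Fintype ι] (k : ℕ) (T : Finset τ) (e : ι → Finset τ)
    (a : τ → ℕ) : Prop :=
  ∀ I ⊆ T, I.Nonempty → excess e I + ∑ v ∈ I, a v + k ≤ k * I.card + I.sup a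

/-- Setting to zero the members of a family outside `I`. -/
def restrictTo [DecidableEq τ] (Ω : Type*) [Field Ω] (k : ℕ) (I : Finset τ) :
    (τ × Fin k → Ω) →ₗ[Ω] (τ × Fin k → Ω) where
  toFun f p := if p.1 ∈ I then f p else 0
  map_add' f g := by ext p; by_cases h : p.1 ∈ I <;> simp [h]
  map_smul' t f := by ext p; by_cases h : p.1 ∈ I <;> simp [h]

variable {Ω : Type*} [Field Ω] {V : Matrix (Fin k) ι Ω} {T I : Finset τ} {e : ι → Finset τ}
  {a : τ → ℕ}

theorem restrictTo_of_mem [DecidableEq τ] {f : τ × Fin k → Ω} {v : τ} (hv : v ∈ I) (i : Fin k) :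
    restrictTo Ω k I f (v, i) = f (v, i) := if_pos hv

theorem restrictTo_of_notMem [DecidableEq τ] {f : τ × Fin k → Ω} {v : τ} (hv : v ∉ I) (i : Fin k) :
    restrictTo Ω k I f (v, i) = 0 := if_neg hv

theorem restrictTo_mem_agreeSpace [DecidableEq τ] (hI : I ⊆ T) {f : τ × Fin k → Ω}
    (hf : f ∈ agreeSpace V T e a) :
    restrictTo Ω k I f ∈ agreeSpace V I e a := by
  obtain ⟨h1, h2, h3⟩ := hf
  refine ⟨fun v i hv => restrictTo_of_notMem hv i, fun j u hu v hv hue hve => ?_,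
    fun i u hu v hv h h' => ?_⟩
  · simp only [restrictTo_of_mem hu, restrictTo_of_mem hv]
    exact h2 j u (hI hu) v (hI hv) hue hve
  · rw [restrictTo_of_mem hu, restrictTo_of_mem hv]
    exact h3 i u (hI hu) v (hI hv) h h'

/-- The constant families already span a space of dimension `k`. -/
theorem apply_eq_of_finrank_agreeSpace_le [DecidableEq τ] [Fintype τ]
    (h : finrank Ω (agreeSpace V I e a) ≤ k) {f : τ × Fin k → Ω}
    (hf : f ∈ agreeSpace V I e a) {u v : τ}
    (hu : u ∈ I) (hv : v ∈ I) (i : Fin k) : f (u, i) = f (v, i) := by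
  let D : (Fin k → Ω) →ₗ[Ω] (τ × Fin k → Ω) :=
    { toFun := fun x p => if p.1 ∈ I then x p.2 else 0
      map_add' := fun x y => by ext p; by_cases h : p.1 ∈ I <;> simp [h]
      map_smul' := fun t x => by ext p; by_cases h : p.1 ∈ I <;> simp [h] }
  have hD : ∀ x w j, w ∈ I → D x (w, j) = x j := fun x w j hw => if_pos hw
  have hinj : Function.Injective D := by
    intro x y hxy
    ext j
    rw [← hD x u j hu, hxy, hD y u j hu]
  have hle : LinearMap.range D ≤ agreeSpace V I e a := by
    rintro _ ⟨x, rfl⟩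
    refine ⟨fun v i hv => if_neg hv, fun j u hu v hv _ _ => ?_, fun i u hu v hv _ _ => ?_⟩
    · simp only [hD x _ _ hu, hD x _ _ hv]
    · simp only [hD x _ _ hu, hD x _ _ hv]
  have hrange : finrank Ω (LinearMap.range D) = k := by
    rw [LinearMap.finrank_range_of_inj hinj]; simp
  have heq := Submodule.eq_of_le_of_finrank_le hle (by omega)
  rw [← heq] at hf
  obtain ⟨x, rfl⟩ := hf
  rw [hD x _ _ hu, hD x _ _ hv]

theorem finrank_agreeSpace_empty [Fintype τ] : finrank Ω (agreeSpace V ∅ e a) = 0 := by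
  have : agreeSpace V ∅ e a = ⊥ := by
    rw [eq_bot_iff]
    rintro f ⟨h, -⟩
    exact funext fun p => h p.1 p.2 (Finset.notMem_empty _)
  rw [this, finrank_bot]

/-- Deleting a vertex of maximal weight: a family vanishing on the other vertices is only free in
the positions not tied to them by the weights. -/
theorem finrank_agreeSpace_le_erase [DecidableEq τ] [Fintype τ] {v : τ} (hv : v ∈ T)
    (hmax : ∀ u ∈ T, a u ≤ a v) :
    finrank Ω (agreeSpace V T e a) ≤
      finrank Ω (agreeSpace V (T.erase v) e a) + (k - (T.erase v).sup a) := by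
  set I := T.erase v with hI
  set s := I.sup a with hs
  let ρ : agreeSpace V T e a →ₗ[Ω] agreeSpace V I e a :=
    (restrictTo Ω k I).restrict fun f hf => restrictTo_mem_agreeSpace (T.erase_subset v) hf
  have h0 : ∀ f ∈ LinearMap.ker ρ, ∀ u ∈ I, ∀ i, (f : τ × Fin k → Ω) (u, i) = 0 := by
    intro f hf u hu i
    have h1 : restrictTo Ω k I f.1 = 0 := congrArg Subtype.val hf
    rw [← restrictTo_of_mem (f := f.1) hu i, h1]; rfl
  have h1 : ∀ f ∈ LinearMap.ker ρ, ∀ i : Fin k, k ≤ s + i → (f : τ × Fin k → Ω) (v, i) = 0 := by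
    intro f hf i hi
    rcases I.eq_empty_or_nonempty with hempty | hne
    · rw [hs, hempty, Finset.sup_empty, Nat.bot_eq_zero] at hi
      have := i.2
      omega
    · obtain ⟨u, hu, hus⟩ := I.exists_mem_eq_sup hne a
      have huT := Finset.mem_of_mem_erase hu
      rw [f.2.2.2 i v hv u huT ?_ ?_, h0 f hf u hu i]
      · have := hmax u huT
        omega
      · omega
  let σ : LinearMap.ker ρ →ₗ[Ω] (Fin (k - s) → Ω) :=
    { toFun := fun f i => (f.1 : τ × Fin k → Ω) (v, Fin.castLE (Nat.sub_le k s) i)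
      map_add' := fun f g => rfl
      map_smul' := fun t f => rfl }
  have hσ : Function.Injective σ := by
    intro f g hfg
    ext ⟨w, i⟩
    by_cases hw : w = v
    · subst hw
      by_cases hi : k ≤ s + i
      · exact (h1 f.1 f.2 i hi).trans (h1 g.1 g.2 i hi).symm
      · exact congrFun hfg ⟨i, by omega⟩
    · by_cases hwT : w ∈ T
      · have hwI := Finset.mem_erase.2 ⟨hw, hwT⟩
        exact (h0 f.1 f.2 w hwI i).trans (h0 g.1 g.2 w hwI i).symm
      · exact (f.1.2.1 w i hwT).trans (g.1.2.1 w i hwT).symm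
  have h2 := LinearMap.finrank_range_add_finrank_ker ρ
  have h3 := LinearMap.finrank_le_finrank_of_injective hσ
  have h4 := Submodule.finrank_le (LinearMap.range ρ)
  simp only [finrank_fintype_fun_eq_card, Fintype.card_fin] at h3
  omega

/-- The edges after contracting `I` to its element `v₀`: an edge meeting `I` acquires `v₀`.
Vertices of `I` other than `v₀` are not removed from the edges, but no longer belong to the vertex
set on which `contractEdges` is used. -/
def contractEdges [DecidableEq τ] (e : ι → Finset τ) (I : Finset τ) (v₀ : τ) (j : ι) : Finset τ :=
  if (e j ∩ I).Nonempty then insert v₀ (e j) else e j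

theorem excess_contractEdges [DecidableEq τ] [Fintype ι] {v₀ : τ} {J : Finset τ}
    (hI : v₀ ∈ I) (hJ : v₀ ∈ J) (hdisj : Disjoint (J.erase v₀) I) :
    excess (contractEdges e I v₀) J + excess e I = excess e (J.erase v₀ ∪ I) := by
  simp only [excess, ← Finset.sum_add_distrib]
  refine Finset.sum_congr rfl fun j _ => ?_
  have h1 : (e j ∩ (J.erase v₀ ∪ I)).card = (e j ∩ J.erase v₀).card + (e j ∩ I).card := by
    rw [Finset.inter_union_distrib_left, Finset.card_union_of_disjoint]
    exact hdisj.mono Finset.inter_subset_right Finset.inter_subset_right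
  by_cases h : (e j ∩ I).Nonempty
  · have h2 : insert v₀ (e j) ∩ J = insert v₀ (e j ∩ J.erase v₀) := by
      ext x; simp only [Finset.mem_inter, Finset.mem_insert, Finset.mem_erase]
      by_cases hx : x = v₀ <;> simp [hx, hJ]
    have h3 : v₀ ∉ e j ∩ J.erase v₀ := by simp
    have h4 := h.card_pos
    rw [contractEdges, if_pos h, h1, h2, Finset.card_insert_of_notMem h3]
    omega
  · have h5 : v₀ ∉ e j := fun h6 => h ⟨v₀, Finset.mem_inter.2 ⟨h6, hI⟩⟩
    have h6 : e j ∩ J.erase v₀ = e j ∩ J := by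
      ext x; simp only [Finset.mem_inter, Finset.mem_erase]
      refine ⟨fun hx => ⟨hx.1, hx.2.2⟩, fun hx => ⟨hx.1, ?_, hx.2⟩⟩
      rintro rfl; exact h5 hx.1
    rw [Finset.not_nonempty_iff_eq_empty] at h
    rw [contractEdges, if_neg (by simp [h]), h1, h6, h]
    simp

theorem excess_contractEdges_of_notMem [DecidableEq τ] [Fintype ι] {v₀ : τ} {J : Finset τ}
    (hJ : v₀ ∉ J) :
    excess (contractEdges e I v₀) J = excess e J := by
  refine Finset.sum_congr rfl fun j _ => ?_
  rw [contractEdges]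
  split_ifs
  · rw [Finset.insert_inter_of_notMem hJ]
  · rfl

/-- If all families on `I` are constant, then `I` can be contracted to `v₀ ∈ I`, with the largest
weight occurring in `I`. -/
theorem finrank_agreeSpace_le_contract [DecidableEq τ] [Fintype τ] {v₀ : τ} (hI : I ⊆ T)
    (hv₀ : v₀ ∈ I) (hk : finrank Ω (agreeSpace V I e a) ≤ k) :
    finrank Ω (agreeSpace V T e a) ≤
      finrank Ω (agreeSpace V (insert v₀ (T \ I)) (contractEdges e I v₀)
        (Function.update a v₀ (I.sup a))) := by
  set T' := insert v₀ (T \ I) with hT'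
  have hconst : ∀ f ∈ agreeSpace V T e a, ∀ u ∈ I, ∀ i, f (u, i) = f (v₀, i) := by
    intro f hf u hu i
    have := apply_eq_of_finrank_agreeSpace_le hk (restrictTo_mem_agreeSpace hI hf) hu hv₀ i
    rwa [restrictTo_of_mem hu, restrictTo_of_mem hv₀] at this
  have hT'T : T' ⊆ T := Finset.insert_subset (hI hv₀) Finset.sdiff_subset
  have hT'I : ∀ u ∈ T', u ≠ v₀ → u ∉ I := by
    intro u hu hne
    rw [hT', Finset.mem_insert] at hu
    exact (Finset.mem_sdiff.1 (hu.resolve_left hne)).2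
  -- a representative in `I` realises each membership that `v₀` acquires
  have hrepE : ∀ j, ∀ u ∈ T', u ∈ contractEdges e I v₀ j → ∃ u' ∈ T, u' ∈ e j ∧
      ∀ f ∈ agreeSpace V T e a, ∀ i, f (u', i) = f (u, i) := by
    intro j u hu hue
    by_cases hmem : u ∈ e j
    · exact ⟨u, hT'T hu, hmem, fun _ _ _ => rfl⟩
    · rw [contractEdges] at hue
      split_ifs at hue with hne
      · obtain ⟨u', hu'⟩ := hne
        rw [Finset.mem_inter] at hu'
        have : u = v₀ := (Finset.mem_insert.1 hue).resolve_right hmem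
        subst this
        exact ⟨u', hI hu'.2, hu'.1, fun f hf i => hconst f hf u' hu'.2 i⟩
      · exact absurd hue hmem
  have hrepA : ∀ u ∈ T', ∃ u' ∈ T, a u' = Function.update a v₀ (I.sup a) u ∧
      ∀ f ∈ agreeSpace V T e a, ∀ i, f (u', i) = f (u, i) := by
    intro u hu
    by_cases h : u = v₀
    · subst h
      obtain ⟨u', hu', hs⟩ := I.exists_mem_eq_sup ⟨u, hv₀⟩ a
      exact ⟨u', hI hu', by simp [hs], fun f hf i => hconst f hf u' hu' i⟩
    · exact ⟨u, hT'T hu, by simp [h], fun _ _ _ => rfl⟩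
  have hmaps : ∀ f ∈ agreeSpace V T e a, restrictTo Ω k T' f ∈
      agreeSpace V T' (contractEdges e I v₀) (Function.update a v₀ (I.sup a)) := by
    intro f hf
    refine ⟨fun v i hv => restrictTo_of_notMem hv i, fun j u hu v hv hue hve => ?_,
      fun i u hu v hv h h' => ?_⟩
    · obtain ⟨u', hu'T, hu'e, hu'⟩ := hrepE j u hu hue
      obtain ⟨v', hv'T, hv'e, hv'⟩ := hrepE j v hv hve
      simp only [restrictTo_of_mem hu, restrictTo_of_mem hv, ← hu' f hf, ← hv' f hf]
      exact hf.2.1 j u' hu'T v' hv'T hu'e hv'e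
    · obtain ⟨u', hu'T, hu'a, hu'⟩ := hrepA u hu
      obtain ⟨v', hv'T, hv'a, hv'⟩ := hrepA v hv
      rw [restrictTo_of_mem hu, restrictTo_of_mem hv, ← hu' f hf, ← hv' f hf]
      exact hf.2.2 i u' hu'T v' hv'T (hu'a ▸ h) (hv'a ▸ h')
  refine LinearMap.finrank_le_finrank_of_injective
    (f := (restrictTo Ω k T').restrict hmaps) ?_
  rw [← LinearMap.ker_eq_bot, LinearMap.ker_eq_bot']
  intro f hf
  have h1 : restrictTo Ω k T' f.1 = 0 := congrArg Subtype.val hf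
  have h2 : ∀ u ∈ T', ∀ i, f.1 (u, i) = 0 := fun u hu i => by
    rw [← restrictTo_of_mem (f := f.1) hu i, h1]; rfl
  ext ⟨u, i⟩
  by_cases huT : u ∈ T
  · by_cases huI : u ∈ I
    · rw [hconst f.1 f.2 u huI i]; exact h2 v₀ (Finset.mem_insert_self _ _) i
    · exact h2 u (Finset.mem_insert_of_mem (Finset.mem_sdiff.2 ⟨huT, huI⟩)) i
  · exact f.2.1 u i huT

end Defs

/-! ### The dimension bound, given that edges can be degenerated -/

section Main
variable {τ ι : Type*} [DecidableEq τ] [Fintype τ] [Fintype ι] [DecidableEq ι] {k : ℕ}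
  {Ω : Type*} [Field Ω]

/-- The dimension bound for sparse weighted hypergraphs. The hypothesis says that an edge through
a vertex of maximal weight may be traded for an increase of the weights of its vertices. -/
theorem finrank_agreeSpace_add_le_of_degeneration {V : Matrix (Fin k) ι Ω}
    (hlim : ∀ (T : Finset τ) (e : ι → Finset τ) (a : τ → ℕ) (n : ι) (v : τ), v ∈ T → v ∈ e n →
      (∀ u ∈ T, a u ≤ a v) → finrank Ω (agreeSpace V T e a) ≤
        finrank Ω (agreeSpace V T (Function.update e n ∅)
          (fun u => a u + if u ∈ e n then 1 else 0)))
    (T : Finset τ) (e : ι → Finset τ) (a : τ → ℕ) (hsp : IsSparse k T e a) :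
    finrank Ω (agreeSpace V T e a) + excess e T + ∑ v ∈ T, a v ≤ k * T.card + T.sup a := by
  induction hN : T.card + (Finset.univ.filter fun j => (e j).Nonempty).card
    using Nat.strong_induction_on generalizing T e a with
  | _ N ih =>
  rcases T.eq_empty_or_nonempty with rfl | hT
  · simp [finrank_agreeSpace_empty, excess]
  by_cases htight : ∃ I ⊆ T, 2 ≤ I.card ∧ I ≠ T ∧
      excess e I + ∑ v ∈ I, a v + k = k * I.card + I.sup a
  -- a tight set is contracted
  · obtain ⟨I, hIT, hI2, hne, hI⟩ := htight
    have hIlt : I.card < T.card := Finset.card_lt_card (hIT.ssubset_of_ne hne)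
    obtain ⟨v₀, hv₀⟩ : I.Nonempty := Finset.card_pos.1 (by omega)
    have h1 := ih _ (by omega) I e a (fun J hJ => hsp J (hJ.trans hIT)) rfl
    have hle := finrank_agreeSpace_le_contract (V := V) (e := e) (a := a) hIT hv₀ (by omega)
    set T' := insert v₀ (T \ I) with hT'
    set a' := Function.update a v₀ (I.sup a) with ha'
    have hT'c : T'.card + I.card = T.card + 1 := by
      rw [hT', Finset.card_insert_of_notMem (by simp [hv₀]), Finset.card_sdiff_of_subset hIT]
      omega
    -- sums over subsets containing the contracted vertex, before and after
    have key : ∀ J ⊆ T', v₀ ∈ J → excess (contractEdges e I v₀) J + excess e I =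
        excess e (J.erase v₀ ∪ I) ∧ ∑ v ∈ J, a' v + ∑ v ∈ I, a v =
          ∑ v ∈ J.erase v₀ ∪ I, a v + I.sup a ∧ J.sup a' = (J.erase v₀ ∪ I).sup a ∧
        (J.erase v₀ ∪ I).card + 1 = J.card + I.card ∧ J.erase v₀ ∪ I ⊆ T := by
      intro J hJ hv
      have hdisj : Disjoint (J.erase v₀) I := by
        rw [Finset.disjoint_left]
        intro x hx hxI
        have := hJ (Finset.mem_of_mem_erase hx)
        rw [hT', Finset.mem_insert] at this
        exact (Finset.mem_sdiff.1 (this.resolve_left (Finset.ne_of_mem_erase hx))).2 hxI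
      have ha'e : ∀ x ∈ J.erase v₀, a' x = a x := fun x hx => by
        rw [ha', Function.update_of_ne (Finset.ne_of_mem_erase hx)]
      have ha'v : a' v₀ = I.sup a := by rw [ha', Function.update_self]
      refine ⟨excess_contractEdges hv₀ hv hdisj, ?_, ?_, ?_, ?_⟩
      · have q1 := Finset.add_sum_erase J a' hv
        have q2 : ∑ x ∈ J.erase v₀, a' x = ∑ x ∈ J.erase v₀, a x := Finset.sum_congr rfl ha'e
        rw [Finset.sum_union hdisj]
        omega
      · rw [Finset.sup_union, ← Finset.sup_congr rfl ha'e, ← ha'v]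
        conv_lhs => rw [← Finset.insert_erase hv]
        rw [Finset.sup_insert, sup_comm]
      · rw [Finset.card_union_of_disjoint hdisj, Finset.card_erase_of_mem hv]
        have := Finset.card_pos.2 ⟨v₀, hv⟩
        omega
      · refine Finset.union_subset (fun x hx => ?_) hIT
        have := hJ (Finset.mem_of_mem_erase hx)
        rw [hT', Finset.mem_insert] at this
        exact (Finset.mem_sdiff.1 (this.resolve_left (Finset.ne_of_mem_erase hx))).1
    have hsp' : IsSparse k T' (contractEdges e I v₀) a' := by
      intro J hJ hJne
      by_cases hv : v₀ ∈ J
      · obtain ⟨e1, e2, e3, e4, e5⟩ := key J hJ hv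
        have := hsp _ e5 ⟨v₀, Finset.mem_union_right _ hv₀⟩
        have e6 : k * (J.erase v₀ ∪ I).card + k = k * J.card + k * I.card := by
          rw [← mul_add, ← e4]; ring
        rw [e3]
        omega
      · have hJT : J ⊆ T := fun x hx => by
          have := hJ hx
          rw [hT', Finset.mem_insert] at this
          exact (Finset.mem_sdiff.1 (this.resolve_left (fun h : x = v₀ => hv (h ▸ hx)))).1
        have ha'e : ∀ x ∈ J, a' x = a x := fun x hx => by
          rw [ha', Function.update_of_ne (fun h : x = v₀ => hv (h ▸ hx))]
        rw [excess_contractEdges_of_notMem hv, Finset.sum_congr rfl ha'e,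
          Finset.sup_congr rfl ha'e]
        exact hsp J hJT hJne
    have hfil : (Finset.univ.filter fun j => (contractEdges e I v₀ j).Nonempty).card ≤
        (Finset.univ.filter fun j => (e j).Nonempty).card := by
      refine Finset.card_le_card fun j hj => Finset.mem_filter.2 ⟨Finset.mem_univ j, ?_⟩
      replace hj := (Finset.mem_filter.1 hj).2
      rw [contractEdges] at hj
      by_cases h : (e j ∩ I).Nonempty
      · exact h.mono Finset.inter_subset_left
      · rwa [if_neg h] at hj
    have h2 := ih _ (by omega) T' _ a' hsp' rfl
    obtain ⟨e1, e2, e3, e4, e5⟩ := key T' subset_rfl (Finset.mem_insert_self _ _)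
    have hTT : T'.erase v₀ ∪ I = T := by
      rw [hT', Finset.erase_insert (by simp [hv₀]), Finset.sdiff_union_of_subset hIT]
    rw [hTT] at e1 e2 e3
    have e6 : k * T.card + k = k * T'.card + k * I.card := by
      rw [← mul_add, hT'c]; ring
    omega
  · push Not at htight
    obtain ⟨v, hv, hmax⟩ := T.exists_max_image a hT
    have hsupT : T.sup a = a v := le_antisymm (Finset.sup_le hmax) (Finset.le_sup hv)
    by_cases hedge : ∃ n, v ∈ e n ∧ 2 ≤ (e n ∩ T).card
    -- an edge through `v` is degenerated
    · obtain ⟨n, hvn, hn2⟩ := hedge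
      have hle := hlim T e a n v hv hvn hmax
      set e' := Function.update e n ∅ with he'
      set a' : τ → ℕ := fun u => a u + if u ∈ e n then 1 else 0 with ha'
      have haa' : ∀ u, a u ≤ a' u := fun u => Nat.le_add_right _ _
      have hex : ∀ J, excess e' J + ((e n ∩ J).card - 1) = excess e J := by
        intro J
        rw [excess, excess, ← Finset.add_sum_erase _ _ (Finset.mem_univ n),
          ← Finset.add_sum_erase _ (fun j => (e j ∩ J).card - 1) (Finset.mem_univ n),
          Finset.sum_congr rfl (fun j hj => by
            rw [he', Function.update_of_ne (Finset.ne_of_mem_erase hj)])]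
        simp [he']
        omega
      have hsum : ∀ J, ∑ u ∈ J, a' u = ∑ u ∈ J, a u + (e n ∩ J).card := by
        intro J
        rw [ha', Finset.sum_add_distrib, Finset.sum_boole, Finset.filter_mem_eq_inter,
          Finset.inter_comm, Nat.cast_id]
      have hsp' : IsSparse k T e' a' := by
        intro J hJ hJne
        have b1 := hex J
        have b2 := hsum J
        have b3 := hsp J hJ hJne
        have b4 : J.sup a ≤ J.sup a' := Finset.sup_mono_fun fun u _ => haa' u
        -- meeting `e n` raises the count by one; the bound survives as `J` is not tight,
        -- or because `v ∈ T` raises the supremum as well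
        by_cases h0 : (e n ∩ J).card = 0
        · omega
        rcases eq_or_ne J T with rfl | hJT
        · have : a' v ≤ J.sup a' := Finset.le_sup hv
          have : a' v = a v + 1 := by simp [ha', hvn]
          omega
        · by_cases hJ2 : 2 ≤ J.card
          · have := htight J hJ hJ2 hJT
            omega
          · have hJ1 : J.card = 1 := by
              have := hJne.card_pos
              omega
            obtain ⟨u, rfl⟩ := Finset.card_eq_one.1 hJ1
            have : excess e' {u} = 0 := by
              refine Finset.sum_eq_zero fun j _ => ?_
              have := Finset.card_le_card (Finset.inter_subset_right (s₁ := e' j) (s₂ := {u}))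
              rw [Finset.card_singleton] at this
              omega
            simp only [Finset.sum_singleton, Finset.card_singleton, Finset.sup_singleton, this]
            omega
      have hfil : (Finset.univ.filter fun j => (e' j).Nonempty).card <
          (Finset.univ.filter fun j => (e j).Nonempty).card := by
        refine Finset.card_lt_card ⟨fun j => ?_, fun hsub => ?_⟩
        · simp only [Finset.mem_filter, Finset.mem_univ, true_and, he']
          by_cases hj : j = n
          · subst hj; simp
          · rw [Function.update_of_ne hj]; exact id
        · have := hsub (Finset.mem_filter.2 ⟨Finset.mem_univ n, v, hvn⟩)
          simp [he'] at this
      have h1 := ih _ (by omega) T e' a' hsp' rfl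
      have h2 : T.sup a' ≤ a v + 1 := by
        refine Finset.sup_le fun u hu => ?_
        have := hmax u hu
        simp only [ha']
        split_ifs <;> omega
      have b1 := hex T
      have b2 := hsum T
      omega
    -- `v` is deleted
    · push Not at hedge
      have hle := finrank_agreeSpace_le_erase (V := V) (e := e) hv hmax
      have hcard := Finset.card_erase_add_one hv
      have h1 := ih _ (by omega) (T.erase v) e a
        (fun J hJ => hsp J (hJ.trans (T.erase_subset v))) rfl
      have hex : excess e (T.erase v) = excess e T := by
        refine Finset.sum_congr rfl fun j _ => ?_
        by_cases hvj : v ∈ e j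
        · have := hedge j hvj
          have := Finset.card_le_card
            (Finset.inter_subset_inter (subset_refl (e j)) (T.erase_subset v))
          omega
        · have : e j ∩ T.erase v = e j ∩ T := by
            rw [Finset.inter_erase, Finset.erase_eq_of_notMem]
            simp [hvj]
          rw [this]
      have hsum := Finset.add_sum_erase T a hv
      have hs : (T.erase v).sup a ≤ k := by
        refine Finset.sup_le fun u hu => ?_
        have huT := Finset.mem_of_mem_erase hu
        have hne := Finset.ne_of_mem_erase hu
        have h2 := hsp {u, v} (by simp [Finset.insert_subset_iff, huT, hv]) (by simp)
        rw [Finset.sum_pair hne, Finset.card_pair hne, Finset.sup_insert, Finset.sup_singleton,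
          sup_eq_right.2 (hmax u huT)] at h2
        omega
      have hk : k * T.card = k * (T.erase v).card + k := by rw [← hcard]; ring
      omega
end Main

/-! ### Degeneration of a coordinate to infinity -/

section Degeneration
variable {τ ι : Type*} {k : ℕ}

/-- The monomial matrix with natural number exponents, which makes sense over any ring. -/
def powMatrix {R : Type*} [CommRing R] (d : Fin k → ℕ) (x : ι → R) : Matrix (Fin k) ι R :=
  Matrix.of fun i j => x j ^ d i

theorem powMatrix_map {R S : Type*} [CommRing R] [CommRing S] (φ : R →+* S) (d : Fin k → ℕ)
    (x : ι → R) : (powMatrix d x).map φ = powMatrix d (fun j => φ (x j)) := by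
  ext i j
  simp [powMatrix]

/-- The limit of the agreement space as `α_n = t⁻¹` tends to infinity. If `u ∈ e n`, the vectors
of `u` and `v` agree in the top `a u` positions, so the agreement of their codewords at `n` forces
the limits to agree in the next position too. -/
theorem finrank_agreeSpace_laurent_le [DecidableEq ι] [Fintype τ] {Ω : Type*} [Field Ω]
    {d : Fin k → ℕ} (hd : StrictMono d) (β : ι → Ω) (T : Finset τ) (e : ι → Finset τ)
    [∀ n, DecidablePred (· ∈ e n)] (a : τ → ℕ)
    (n : ι) (v : τ) (hv : v ∈ T) (hvn : v ∈ e n) (hmax : ∀ u ∈ T, a u ≤ a v) :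
    finrank (LaurentSeries Ω) (agreeSpace (powMatrix d (Function.update
      (fun j => (HahnSeries.C (β j) : LaurentSeries Ω)) n (HahnSeries.single (-1) 1))) T e a) ≤
    finrank Ω (agreeSpace (powMatrix d β) T (Function.update e n ∅)
      (fun u => a u + if u ∈ e n then 1 else 0)) := by
  refine finrank_le_of_coeff_zero_mem _ _ ?_
  rintro s ⟨h1, h2, h3⟩ hint
  -- every position of `u` in the range of the new weight is tied to the same position of `v`
  have key : ∀ (i : Fin k) (u : τ), u ∈ T → k ≤ (a u + if u ∈ e n then 1 else 0) + i →
      (s (u, i)).coeff 0 = (s (v, i)).coeff 0 := by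
    intro i u hu hi
    have huv := hmax u hu
    by_cases hle : k ≤ a u + i
    · rw [h3 i u hu v hv hle (by omega)]
    · have hun : u ∈ e n := by
        by_contra hun
        rw [if_neg hun] at hi
        exact hle hi
      rw [if_pos hun] at hi
      have heq := h2 n u hu v hv hun hvn
      rw [← sub_eq_zero, ← Finset.sum_sub_distrib] at heq
      -- here `k = a u + 1 + i`, and the coefficient of `t ^ (-d i)` isolates position `i`: higher
      -- positions cancel, and lower ones are multiplied by too small a power of `t⁻¹`
      have heq' := congrArg (fun y : LaurentSeries Ω => y.coeff (-(d i : ℤ))) heq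
      simp only [HahnSeries.coeff_sum, HahnSeries.coeff_zero] at heq'
      rw [Finset.sum_eq_single i] at heq'
      · simpa [powMatrix, HahnSeries.single_pow, HahnSeries.coeff_single_mul, sub_eq_zero]
          using heq'
      · intro i' _ hne
        rcases lt_or_gt_of_ne hne with hlt | hgt
        · have : -(d i : ℤ) + d i' < 0 := by
            have := hd hlt
            omega
          simp [powMatrix, HahnSeries.single_pow, HahnSeries.coeff_single_mul, hint _ _ this]
        · have hlt : (i : ℕ) < i' := hgt
          rw [h3 i' u hu v hv (by omega) (by omega), sub_self, HahnSeries.coeff_zero]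
      · simp
  refine ⟨fun w i hw => ?_, fun j u hu w hw hue hwe => ?_, fun i u hu w hw hi hi' => ?_⟩
  · simp [h1 w i hw]
  · by_cases hj : j = n
    · subst hj
      simp at hue
    · rw [Function.update_of_ne hj] at hue hwe
      have heq := congrArg (fun y : LaurentSeries Ω => y.coeff 0) (h2 j u hu w hw hue hwe)
      simp only [HahnSeries.coeff_sum] at heq
      simpa only [powMatrix, Matrix.of_apply, Function.update_of_ne hj, ← map_pow,
        HahnSeries.C_mul_eq_smul, HahnSeries.coeff_smul, smul_eq_mul] using heq
  · exact (key i u hu hi).trans (key i w hw hi').symm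

/-- The dimension bound at the generic point, where the `α_j` are the variables of a rational
function field. -/
theorem finrank_agreeSpace_generic_le [DecidableEq τ] [Fintype τ] [Fintype ι] (F : Type*) [Field F]
    {d : Fin k → ℕ} (hd : StrictMono d) (T : Finset τ) (e : ι → Finset τ)
    (hsp : IsSparse k T e 0) :
    finrank (FractionRing (MvPolynomial ι F)) (agreeSpace (powMatrix d fun j =>
      algebraMap (MvPolynomial ι F) (FractionRing (MvPolynomial ι F)) (MvPolynomial.X j)) T e 0) +
      excess e T ≤ k * T.card := by
  classical
  have := finrank_agreeSpace_add_le_of_degeneration (V := powMatrix d fun j =>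
      algebraMap (MvPolynomial ι F) (FractionRing (MvPolynomial ι F)) (MvPolynomial.X j))
    (fun T e a n v hv hvn hmax => ?_) T e 0 hsp
  · have h0 : T.sup (0 : τ → ℕ) = 0 := by simp
    rw [h0] at this
    simpa using this
  · set Ω := FractionRing (MvPolynomial ι F)
    set β : ι → Ω := fun j => algebraMap (MvPolynomial ι F) Ω (MvPolynomial.X j) with hβ
    set α : ι → LaurentSeries Ω := Function.update
      (fun j => (HahnSeries.C (β j) : LaurentSeries Ω)) n (HahnSeries.single (-1) 1) with hα
    refine le_trans ?_ (finrank_agreeSpace_laurent_le hd β T e a n v hv hvn hmax)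
    let φ : MvPolynomial ι F →+* LaurentSeries Ω :=
      MvPolynomial.eval₂Hom ((HahnSeries.C : Ω →+* LaurentSeries Ω).comp (algebraMap F Ω)) α
    -- the Laurent point is a specialization of the generic one, so its bound carries over
    obtain ⟨P, hP, hle⟩ := exists_ne_zero_finrank_solutionSpace_le φ
      (agreeForms (powMatrix d MvPolynomial.X) T e a)
    have hψ : algebraMap (MvPolynomial ι F) Ω P ≠ 0 := by
      rw [Ne, IsFractionRing.to_map_eq_zero_iff]
      rintro rfl
      exact hP (map_zero φ)
    have := hle (algebraMap (MvPolynomial ι F) Ω) hψ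
    have hφ : (fun j => φ (MvPolynomial.X j)) = α :=
      funext fun j => MvPolynomial.eval₂Hom_X' _ _ _
    rwa [solutionSpace_agreeForms, solutionSpace_agreeForms, powMatrix_map, powMatrix_map,
      hφ] at this

end Degeneration

/-! ### General position -/

section GeneralPosition
variable {τ ι : Type*} [DecidableEq τ] [Fintype ι] {k : ℕ}

/-- The columns of `V` impose independent agreement conditions along every sparse hypergraph with
vertices in `τ` (and zero weights). -/
def InGeneralPosition {Ω : Type*} [Field Ω] (τ : Type*) [DecidableEq τ] [Fintype τ]
    (V : Matrix (Fin k) ι Ω) : Prop :=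
  ∀ (T : Finset τ) (e : ι → Finset τ), IsSparse k T e 0 →
    finrank Ω (agreeSpace V T e 0) + excess e T ≤ k * T.card

theorem exists_ne_zero_inGeneralPosition (F L τ : Type*) [Field F] [Field L] [Algebra F L]
    [DecidableEq τ] [Fintype τ] {n : ℕ} {e : Fin k → ℤ} (he : StrictMono e) :
    ∃ P : MvPolynomial (Fin n) F, P ≠ 0 ∧ ∀ α : Fin n → L, MvPolynomial.aeval α P ≠ 0 →
      InGeneralPosition τ (monomialMatrix e α) := by
  classical
  -- shifting all exponents by `N` rescales the columns and makes the exponents nonnegative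
  set N : ℤ := ∑ i, |e i| with hN
  have hpos : ∀ i, 0 ≤ e i + N := fun i => by
    have h1 : |e i| ≤ N := Finset.single_le_sum (f := fun i => |e i|)
      (fun i _ => abs_nonneg _) (Finset.mem_univ i)
    have h2 := neg_abs_le (e i)
    omega
  set d : Fin k → ℕ := fun i => (e i + N).toNat with hd
  have hdcast : ∀ i, (d i : ℤ) = e i + N := fun i => Int.toNat_of_nonneg (hpos i)
  have hdmono : StrictMono d := fun i j hij => by
    have h1 := hdcast i
    have h2 := hdcast j
    have h3 := he hij
    omega
  have hP := fun p : Finset τ × (Fin n → Finset τ) => exists_ne_zero_finrank_solutionSpace_le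
    (algebraMap (MvPolynomial (Fin n) F) (FractionRing (MvPolynomial (Fin n) F)))
    (agreeForms (powMatrix d MvPolynomial.X) p.1 p.2 0)
  choose P hP0 hP using hP
  refine ⟨(∏ j, MvPolynomial.X j) * ∏ p, P p, mul_ne_zero ?_ ?_, fun α hα T E hsp => ?_⟩
  · exact Finset.prod_ne_zero_iff.2 fun j _ => MvPolynomial.X_ne_zero j
  · refine Finset.prod_ne_zero_iff.2 fun p _ h => hP0 p ?_
    rw [h, map_zero]
  · rw [map_mul, map_prod, map_prod] at hα
    have hα0 : ∀ j, α j ≠ 0 := fun j => by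
      have := Finset.prod_ne_zero_iff.1 (left_ne_zero_of_mul hα) j (Finset.mem_univ j)
      rwa [MvPolynomial.aeval_X] at this
    have h1 := hP (T, E) (MvPolynomial.aeval α : MvPolynomial (Fin n) F →ₐ[F] L).toRingHom
      (Finset.prod_ne_zero_iff.1 (right_ne_zero_of_mul hα) (T, E) (Finset.mem_univ _))
    rw [solutionSpace_agreeForms, solutionSpace_agreeForms, powMatrix_map, powMatrix_map] at h1
    have h2 := finrank_agreeSpace_generic_le F hdmono T E hsp
    have h3 : agreeSpace (monomialMatrix e α) T E 0 = agreeSpace (powMatrix d α) T E 0 := by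
      have hmul : ∀ i j, powMatrix d α i j = α j ^ N * monomialMatrix e α i j := fun i j => by
        simp only [powMatrix, monomialMatrix, Matrix.of_apply]
        rw [← zpow_natCast, hdcast, add_comm, zpow_add₀ (hα0 j)]
      ext f
      simp only [mem_agreeSpace, hmul, mul_assoc, ← Finset.mul_sum,
        mul_right_inj' (zpow_ne_zero N (hα0 _))]
    rw [h3]
    have h4 : (fun j => (MvPolynomial.aeval α : MvPolynomial (Fin n) F →ₐ[F] L).toRingHom
        (MvPolynomial.X j)) = α := funext fun j => MvPolynomial.aeval_X _ _
    rw [h4] at h1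
    exact (Nat.add_le_add_right h1 _).trans h2

theorem isSparse_zero_iff {T : Finset τ} {e : ι → Finset τ} :
    IsSparse k T e 0 ↔ ∀ I ⊆ T, I.Nonempty → excess e I + k ≤ k * I.card := by
  refine forall₃_congr fun I _ _ => ?_
  have : I.sup (0 : τ → ℕ) = 0 := by simp
  rw [this]
  simp

theorem excess_add_excess_le (e : ι → Finset τ) (I J : Finset τ) :
    excess e I + excess e J ≤ excess e (I ∪ J) + excess e (I ∩ J) := by
  simp only [excess, ← Finset.sum_add_distrib]
  refine Finset.sum_le_sum fun j _ => ?_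
  have h1 := Finset.card_union_add_card_inter (e j ∩ I) (e j ∩ J)
  rw [← Finset.inter_union_distrib_left, ← Finset.inter_inter_distrib_left] at h1
  have h2 : (e j ∩ I).card ≤ (e j ∩ (I ∪ J)).card :=
    Finset.card_le_card (Finset.inter_subset_inter subset_rfl Finset.subset_union_left)
  have h3 : (e j ∩ J).card ≤ (e j ∩ (I ∪ J)).card :=
    Finset.card_le_card (Finset.inter_subset_inter subset_rfl Finset.subset_union_right)
  omega

/-- A maximal sparse subhypergraph: a vertex that cannot be added to an edge lies in a tight set
meeting that edge. -/
theorem exists_maximal_sparse [Fintype τ] (T : Finset τ) (E : ι → Finset τ) :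
    ∃ e : ι → Finset τ, (∀ j, e j ⊆ E j ∩ T) ∧ IsSparse k T e 0 ∧
      ∀ j, ∀ u ∈ E j ∩ T, u ∉ e j → ∃ I ⊆ T, u ∈ I ∧ (∃ w ∈ e j, w ∈ I) ∧
        excess e I + k = k * I.card := by
  classical
  -- nonempty edges are kept nonempty, so that they keep meeting a block of the tight partition
  let S : Set (ι → Finset τ) := {e | (∀ j, e j ⊆ E j ∩ T) ∧
    (∀ j, (E j ∩ T).Nonempty → (e j).Nonempty) ∧ IsSparse k T e 0}
  obtain ⟨e, ⟨he, hne, hsp⟩, hmax⟩ : ∃ e ∈ S, ∀ e' ∈ S, ∑ j, (e' j).card ≤ ∑ j, (e j).card := by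
    refine Set.exists_max_image S _ (Set.toFinite S) ?_
    refine ⟨fun j => if h : (E j ∩ T).Nonempty then {h.choose} else ∅, fun j => ?_,
      fun j h => by simp [h], ?_⟩
    · dsimp only
      split_ifs with h
      · simpa only [Finset.singleton_subset_iff] using h.choose_spec
      · simp
    · rw [isSparse_zero_iff]
      intro I _ hI
      have : excess (fun j => if h : (E j ∩ T).Nonempty then {h.choose} else ∅) I = 0 := by
        refine Finset.sum_eq_zero fun j _ => ?_
        refine Nat.sub_eq_zero_of_le ((Finset.card_le_card Finset.inter_subset_left).trans ?_)
        dsimp only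
        split_ifs <;> simp
      rw [this, zero_add]
      exact Nat.le_mul_of_pos_right k hI.card_pos
  refine ⟨e, he, hsp, fun j u hu hue => ?_⟩
  set e' := Function.update e j (insert u (e j)) with he'
  have hins : (e' j) = insert u (e j) := by simp [he']
  have hoth : ∀ j', j' ≠ j → e' j' = e j' := fun j' h => by rw [he', Function.update_of_ne h]
  have hns : ¬ IsSparse k T e' 0 := by
    intro h
    have h1 : ∑ j, (e' j).card ≤ ∑ j, (e j).card := by
      refine hmax e' ⟨fun j' => ?_, fun j' hj' => ?_, h⟩
      · by_cases hj : j' = j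
        · subst hj; rw [hins]; exact Finset.insert_subset hu (he _)
        · rw [hoth _ hj]; exact he _
      · by_cases hj : j' = j
        · subst hj; rw [hins]; exact Finset.insert_nonempty _ _
        · rw [hoth _ hj]; exact hne _ hj'
    have h2 : ∑ j, (e j).card < ∑ j, (e' j).card := by
      refine Finset.sum_lt_sum (fun j' _ => ?_) ⟨j, Finset.mem_univ j, ?_⟩
      · by_cases hj : j' = j
        · subst hj; rw [hins]; exact Finset.card_le_card (Finset.subset_insert _ _)
        · rw [hoth _ hj]
      · rw [hins, Finset.card_insert_of_notMem hue]; omega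
    omega
  rw [isSparse_zero_iff] at hns hsp
  push Not at hns
  obtain ⟨I, hIT, hI, hlt⟩ := hns
  have hsum : excess e' I + ((e j ∩ I).card - 1) = excess e I + ((e' j ∩ I).card - 1) := by
    rw [excess, excess, ← Finset.add_sum_erase _ _ (Finset.mem_univ j),
      ← Finset.add_sum_erase _ (fun j => (e j ∩ I).card - 1) (Finset.mem_univ j),
      Finset.sum_congr rfl (fun j' hj' => by rw [hoth _ (Finset.ne_of_mem_erase hj')])]
    omega
  have h1 := hsp I hIT hI
  by_cases huI : u ∈ I
  · have hc : (e' j ∩ I).card = (e j ∩ I).card + 1 := by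
      rw [hins, Finset.insert_inter_of_mem huI, Finset.card_insert_of_notMem (by simp [hue])]
    refine ⟨I, hIT, huI, ?_, by omega⟩
    have : 0 < (e j ∩ I).card := by omega
    obtain ⟨w, hw⟩ := Finset.card_pos.1 this
    exact ⟨w, Finset.mem_of_mem_inter_left hw, Finset.mem_of_mem_inter_right hw⟩
  · rw [hins, Finset.insert_inter_of_notMem huI] at hsum
    omega

/-- For an arbitrary hypergraph there is a partition of `T`, into the fibres of `r`, such that
agreeing families are constant on blocks, and the dimension is bounded by what the hypergraph
induced on the set of blocks predicts. The map `r` sends a vertex to the maximal tight set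
containing it in a maximal sparse subhypergraph. -/
theorem InGeneralPosition.exists_blocks [Fintype τ] {Ω : Type*} [Field Ω] {V : Matrix (Fin k) ι Ω}
    (hV : InGeneralPosition τ V) (T : Finset τ) (E : ι → Finset τ) :
    ∃ r : τ → Finset τ, (∀ f ∈ agreeSpace V T E 0, ∀ u ∈ T, ∀ v ∈ T, r u = r v →
        ∀ i, f (u, i) = f (v, i)) ∧
      finrank Ω (agreeSpace V T E 0) + ∑ j, (((E j ∩ T).image r).card - 1) ≤
        k * (T.image r).card := by
  classical
  obtain ⟨e, heE, hsp, hmax⟩ := exists_maximal_sparse (k := k) T E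
  have hsp0 := isSparse_zero_iff.1 hsp
  -- the maximal tight set containing `u`
  have hex : ∀ u ∈ T, ∃ B : Finset τ, B ⊆ T ∧ u ∈ B ∧ excess e B + k = k * B.card ∧
      ∀ I ⊆ T, u ∈ I → excess e I + k = k * I.card → I ⊆ B := by
    intro u hu
    obtain ⟨B, hB, hBmax⟩ := Set.exists_max_image
      {B : Finset τ | B ⊆ T ∧ u ∈ B ∧ excess e B + k = k * B.card} Finset.card (Set.toFinite _)
      ⟨{u}, by simpa using hu, by simp, by
        have : excess e {u} = 0 := by
          refine Finset.sum_eq_zero fun j _ => Nat.sub_eq_zero_of_le ?_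
          exact (Finset.card_le_card Finset.inter_subset_right).trans_eq (Finset.card_singleton u)
        simp [this]⟩
    obtain ⟨hBT, huB, hB⟩ := hB
    refine ⟨B, hBT, huB, hB, fun I hIT huI hI => ?_⟩
    have h1 := excess_add_excess_le e B I
    have h2 := hsp0 (B ∩ I) (Finset.inter_subset_left.trans hBT)
      ⟨u, Finset.mem_inter.2 ⟨huB, huI⟩⟩
    have h3 := hsp0 (B ∪ I) (Finset.union_subset hBT hIT) ⟨u, Finset.mem_union_left _ huB⟩
    have h4 : k * (B ∪ I).card + k * (B ∩ I).card = k * B.card + k * I.card := by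
      rw [← mul_add, ← mul_add, Finset.card_union_add_card_inter]
    have h5 := hBmax (B ∪ I) ⟨Finset.union_subset hBT hIT, Finset.mem_union_left _ huB, by omega⟩
    rw [Finset.eq_of_subset_of_card_le Finset.subset_union_left h5]
    exact Finset.subset_union_right
  choose! r hrT hr hrtight hrmax using hex
  have hreq : ∀ u ∈ T, ∀ v ∈ r u, r v = r u := by
    intro u hu v hv
    have hvT := hrT u hu hv
    have h1 : r u ⊆ r v := hrmax v hvT (r u) (hrT u hu) hv (hrtight u hu)
    exact (hrmax u hu (r v) (hrT v hvT) (h1 (hr u hu)) (hrtight v hvT)).antisymm h1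
  have hriff : ∀ u ∈ T, ∀ v ∈ T, r v = r u ↔ v ∈ r u := fun u hu v hv =>
    ⟨fun h => h ▸ hr v hv, hreq u hu v⟩
  have hle : agreeSpace V T E 0 ≤ agreeSpace V T e 0 := fun f hf =>
    ⟨hf.1, fun j u hu v hv hue hve => hf.2.1 j u hu v hv
      (Finset.mem_of_mem_inter_left (heE j hue)) (Finset.mem_of_mem_inter_left (heE j hve)),
      hf.2.2⟩
  refine ⟨r, fun f hf u hu v hv huv i => ?_, ?_⟩
  · have h1 := hV (r u) e (isSparse_zero_iff.2 fun I hI => hsp0 I (hI.trans (hrT u hu)))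
    have h2 := hrtight u hu
    have hvu : v ∈ r u := huv ▸ hr v hv
    have := apply_eq_of_finrank_agreeSpace_le (by omega)
      (restrictTo_mem_agreeSpace (hrT u hu) (hle hf)) (hr u hu) hvu i
    rwa [restrictTo_of_mem (hr u hu), restrictTo_of_mem hvu] at this
  · have h1 := hV T e hsp
    have h2 := Submodule.finrank_mono hle
    have himg : ∀ j, (E j ∩ T).image r ⊆ (e j).image r := by
      intro j B hB
      obtain ⟨u, hu, rfl⟩ := Finset.mem_image.1 hB
      by_cases hue : u ∈ e j
      · exact Finset.mem_image_of_mem r hue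
      · obtain ⟨I, hIT, huI, ⟨w, hwe, hwI⟩, hI⟩ := hmax j u hu hue
        have huT := Finset.mem_of_mem_inter_right hu
        exact Finset.mem_image.2 ⟨w, hwe, hreq u huT w (hrmax u huT I hIT huI hI hwI)⟩
    have hcell : ∀ S ⊆ T, ∀ B ∈ T.image r, S.filter (fun a => r a = B) = S ∩ B := by
      intro S hS B hB
      obtain ⟨u, hu, rfl⟩ := Finset.mem_image.1 hB
      ext a
      simp only [Finset.mem_filter, Finset.mem_inter]
      exact and_congr_right fun ha => hriff u hu a (hS ha)
    -- the conditions of an edge split into those between blocks and those inside blocks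
    have hj : ∀ j, (((e j).image r).card - 1) + ∑ B ∈ T.image r, ((e j ∩ B).card - 1) ≤
        (e j ∩ T).card - 1 := by
      intro j
      have hejT : e j ⊆ T := (heE j).trans Finset.inter_subset_right
      rw [Finset.inter_eq_left.2 hejT]
      have h3 : ∑ B ∈ T.image r, ((e j ∩ B).card - 1) =
          ∑ B ∈ (e j).image r, ((e j ∩ B).card - 1) := by
        symm
        refine Finset.sum_subset (Finset.image_subset_image hejT) fun B hB hB' => ?_
        have h0 : (e j).filter (fun a => r a = B) = ∅ := Finset.filter_eq_empty_iff.2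
          fun a ha hra => hB' (Finset.mem_image.2 ⟨a, ha, hra⟩)
        rw [← hcell _ hejT B hB, h0, Finset.card_empty, Nat.zero_sub]
      have h4 : (e j).card = ∑ B ∈ (e j).image r, (((e j ∩ B).card - 1) + 1) := by
        rw [Finset.card_eq_sum_card_image r (e j)]
        refine Finset.sum_congr rfl fun B hB => ?_
        rw [hcell _ hejT B (Finset.image_subset_image hejT hB)]
        obtain ⟨u, hu, rfl⟩ := Finset.mem_image.1 hB
        have : 0 < (e j ∩ r u).card :=
          Finset.card_pos.2 ⟨u, Finset.mem_inter.2 ⟨hu, hr u (hejT hu)⟩⟩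
        omega
      rw [Finset.sum_add_distrib, Finset.sum_const, smul_eq_mul, mul_one] at h4
      rcases (e j).eq_empty_or_nonempty with h5 | h5
      · simp [h5]
      · have := (h5.image r).card_pos
        omega
    have hB : ∑ B ∈ T.image r, excess e B + k * (T.image r).card = k * T.card := by
      rw [Finset.card_eq_sum_card_image r T, mul_comm k, ← smul_eq_mul (T.image r).card,
        ← Finset.sum_const, ← Finset.sum_add_distrib, Finset.mul_sum]
      refine Finset.sum_congr rfl fun B hB => ?_
      rw [hcell T subset_rfl B hB]
      obtain ⟨u, hu, rfl⟩ := Finset.mem_image.1 hB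
      rw [Finset.inter_eq_right.2 (hrT u hu)]
      exact hrtight u hu
    have hsum : ∑ j, (((E j ∩ T).image r).card - 1) + ∑ B ∈ T.image r, excess e B ≤
        excess e T := by
      simp only [excess]
      rw [Finset.sum_comm, ← Finset.sum_add_distrib]
      refine Finset.sum_le_sum fun j _ => le_trans ?_ (hj j)
      have := Finset.card_le_card (himg j)
      omega
    omega

end GeneralPosition

/-! ### Rank and list decoding -/

section Code
variable {F : Type*} [Field F] {k n : ℕ} {V : Matrix (Fin k) (Fin n) F}

/-- Any `k` columns are linearly independent: apply general position to two vertices joined by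
`k` edges. -/
theorem InGeneralPosition.eq_zero_of_card_le (hV : InGeneralPosition Bool V)
    {S : Finset (Fin n)} (hS : k ≤ S.card) {x : Fin k → F}
    (hx : ∀ j ∈ S, ∑ i, V i j * x i = 0) : x = 0 := by
  obtain ⟨S', hS'S, hS'⟩ := Finset.exists_subset_card_eq hS
  let E : Fin n → Finset Bool := fun j => if j ∈ S' then Finset.univ else ∅
  have hexc : excess E Finset.univ = k := by
    have : ∀ j, (E j ∩ Finset.univ).card - 1 = if j ∈ S' then 1 else 0 := by
      intro j
      simp only [E]
      split_ifs <;> simp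
    simp only [excess, this]
    simp [hS']
  have hle := hV Finset.univ E <| isSparse_zero_iff.2 fun I _ hI => by
    rcases (show I.card = 1 ∨ I.card = 2 by
      have := hI.card_pos
      have := Finset.card_le_univ I
      rw [Fintype.card_bool] at this
      omega) with h1 | h2
    · have : excess E I = 0 := Finset.sum_eq_zero fun j _ => Nat.sub_eq_zero_of_le <|
        (Finset.card_le_card Finset.inter_subset_right).trans_eq h1
      rw [this, h1]; omega
    · have : I = Finset.univ := Finset.card_eq_iff_eq_univ I |>.1 (by rw [h2, Fintype.card_bool])
      rw [this, hexc, Finset.card_univ, Fintype.card_bool]; omega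
  rw [hexc, Finset.card_univ, Fintype.card_bool] at hle
  let f : Bool × Fin k → F := fun p => if p.1 then x p.2 else 0
  have hf : f ∈ agreeSpace V Finset.univ E 0 := by
    have h0 : ∀ j ∈ S', ∀ b, ∑ i, V i j * f (b, i) = 0 := by
      intro j hj b
      cases b
      · simp [f]
      · simpa [f] using hx j (hS'S hj)
    refine ⟨fun v i hv => absurd (Finset.mem_univ v) hv, fun j u _ v _ hu hv => ?_,
      fun i u _ v _ hi _ => ?_⟩
    · by_cases hj : j ∈ S'
      · rw [h0 j hj, h0 j hj]
      · simp [E, hj] at hu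
    · have := i.2
      simp at hi
      omega
  ext i
  exact apply_eq_of_finrank_agreeSpace_le (by omega) hf (Finset.mem_univ true)
    (Finset.mem_univ false) i

theorem linearIndependent_rows (hkn : k ≤ n) (hV : InGeneralPosition Bool V) :
    LinearIndependent F V.row := by
  rw [Fintype.linearIndependent_iff]
  intro x hx i
  refine congrFun (hV.eq_zero_of_card_le (S := Finset.univ) (by simpa) fun j _ => ?_) i
  have := congrFun hx j
  simpa [mul_comm] using this

theorem rank_of_inGeneralPosition (hkn : k ≤ n) (hV : InGeneralPosition Bool V) : V.rank = k := by
  simpa using (linearIndependent_rows hkn hV).rank_matrix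

theorem finrank_rowCode (hkn : k ≤ n) (hV : InGeneralPosition Bool V) :
    finrank F (rowCode V) = k :=
  (finrank_span_eq_card (linearIndependent_rows hkn hV)).trans (Fintype.card_fin k)

theorem mem_rowCode {c : Fin n → F} :
    c ∈ rowCode V ↔ ∃ x : Fin k → F, V.transpose.mulVec x = c := by
  rw [rowCode, Submodule.mem_span_range_iff_exists_fun]
  refine exists_congr fun x => ?_
  rw [← Matrix.vecMul_transpose, Matrix.transpose_transpose, Matrix.vecMul_eq_sum]

theorem sum_card_filter_mem (T : Finset (Finset (Fin n))) :
    ∑ j, (T.filter fun A => j ∈ A).card = ∑ A ∈ T, A.card := by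
  have := Finset.sum_card_bipartiteAbove_eq_sum_card_bipartiteBelow
    (s := (Finset.univ : Finset (Fin n))) (t := T) (fun j A => j ∈ A)
  simpa [Finset.bipartiteAbove, Finset.bipartiteBelow] using this

/-- Codewords that agree with `y` on sets of large total size cannot be distinct. The codewords
are indexed by their agreement sets. -/
theorem InGeneralPosition.card_le_one_of_agree (hV : InGeneralPosition (Finset (Fin n)) V)
    (T : Finset (Finset (Fin n))) (x : Finset (Fin n) → Fin k → F) (y : Fin n → F)
    (hagree : ∀ A ∈ T, ∀ j ∈ A, ∑ i, V i j * x A i = y j)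
    (hinj : ∀ A ∈ T, ∀ B ∈ T, x A = x B → A = B) (hT : n + k * T.card ≤ ∑ A ∈ T, A.card + k) :
    T.card ≤ 1 := by
  let E : Fin n → Finset (Finset (Fin n)) := fun j => Finset.univ.filter fun A => j ∈ A
  have hET : ∀ j, E j ∩ T = T.filter fun A => j ∈ A := fun j => by
    ext A; simp [E, and_comm]
  obtain ⟨r, hconst, hr⟩ := hV.exists_blocks T E
  let f : Finset (Fin n) × Fin k → F := fun p => if p.1 ∈ T then x p.1 p.2 else 0
  have hfx : ∀ A ∈ T, ∀ i, f (A, i) = x A i := fun A hA i => if_pos hA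
  have hf : f ∈ agreeSpace V T E 0 := by
    refine ⟨fun A i hA => if_neg hA, fun j A hA B hB hjA hjB => ?_, fun i A _ B _ hi _ => ?_⟩
    · simp only [hfx A hA, hfx B hB]
      rw [hagree A hA j (by simpa [E] using hjA), hagree B hB j (by simpa [E] using hjB)]
    · have := i.2
      simp at hi
      omega
  -- distinct codewords lie in distinct blocks
  have hrinj : Set.InjOn r T := fun A hA B hB hAB => hinj A hA B hB <| funext fun i => by
    rw [← hfx A hA, ← hfx B hB]
    exact hconst f hf A hA B hB hAB i
  rw [Finset.card_image_of_injOn hrinj] at hr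
  have h1 : ∑ A ∈ T, A.card ≤ ∑ j, (((E j ∩ T).image r).card - 1) + n := by
    have : ∀ j, (T.filter fun A => j ∈ A).card ≤ (((E j ∩ T).image r).card - 1) + 1 := by
      intro j
      rw [Finset.card_image_of_injOn (hrinj.mono (by
        exact_mod_cast Finset.inter_subset_right)), hET]
      omega
    rw [← sum_card_filter_mem]
    refine (Finset.sum_le_sum fun j _ => this j).trans_eq ?_
    rw [Finset.sum_add_distrib]
    simp
  rw [Finset.card_le_one]
  intro A hA B hB
  refine hinj A hA B hB (funext fun i => ?_)
  rw [← hfx A hA, ← hfx B hB]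
  exact apply_eq_of_finrank_agreeSpace_le (by omega) hf hA hB i

theorem isLDMDS_of_inGeneralPosition (hkn : k ≤ n) (hV : InGeneralPosition Bool V)
    (hV' : InGeneralPosition (Finset (Fin n)) V) (L : ℕ) : IsLDMDS L (rowCode V) := by
  classical
  rintro m hm - ⟨c, y, hc, hcC, hρ⟩
  rw [finrank_rowCode hkn hV] at hρ
  have hn : 0 < n := by
    rcases Nat.eq_zero_or_pos n with rfl | h
    · have h01 : (0 : Fin (m + 1)) = Fin.last m := hc (Subsingleton.elim _ _)
      have := congrArg Fin.val h01
      simp at this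
      omega
    · exact h
  let S : Fin (m + 1) → Finset (Fin n) := fun i => Finset.univ.filter fun j => c i j = y j
  have hwt : ∀ i, hammingNorm (c i - y) + (S i).card = n := by
    intro i
    have := Finset.card_filter_add_card_filter_not (s := (Finset.univ : Finset (Fin n)))
      (fun j => c i j = y j)
    rw [Finset.card_univ, Fintype.card_fin] at this
    refine Eq.trans ?_ this
    rw [hammingNorm, add_comm]
    simp [S, sub_eq_zero]
  -- the average-radius bound in integers
  have hbound : (m + 1) * n + m * k ≤ m * n + ∑ i, (S i).card := by
    have h1 : (∑ i, (hammingNorm (c i - y) : ℝ)) ≤ m * ((n : ℝ) - k) := by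
      have hn' : (n : ℝ) ≠ 0 := by positivity
      have hm' : (0 : ℝ) < (m : ℝ) + 1 := by positivity
      have e1 : (m : ℝ) / (m + 1) * (((n : ℝ) - k) / n) * n =
          1 / ((m : ℝ) + 1) * (m * (n - k)) := by
        field_simp
      rw [e1] at hρ
      exact le_of_mul_le_mul_left hρ (by positivity)
    have h2 : ∑ i, hammingNorm (c i - y) + ∑ i, (S i).card = (m + 1) * n := by
      rw [← Finset.sum_add_distrib, Finset.sum_congr rfl fun i _ => hwt i]
      simp
    have h3 : (∑ i, hammingNorm (c i - y)) + m * k ≤ m * n := by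
      have : ((∑ i, hammingNorm (c i - y) : ℕ) : ℝ) + m * k ≤ m * n := by
        push_cast
        linarith
      exact_mod_cast this
    omega
  choose f hf using fun i => mem_rowCode.1 (hcC i)
  have hfc : ∀ i j, ∑ a, V a j * f i a = c i j := fun i j => congrFun (hf i) j
  have hfinj : Function.Injective f := fun i i' h => hc (by rw [← hf i, ← hf i', h])
  -- discarding codewords with fewer than `k` agreements only improves the bound
  let I : Finset (Fin (m + 1)) := Finset.univ.filter fun i => k ≤ (S i).card
  -- a codeword is determined by `k` of its coordinates
  have hSinj : Set.InjOn S I := by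
    intro i hi i' _ hSS
    have hi' : k ≤ (S i).card := by simpa [I] using hi
    refine hfinj (sub_eq_zero.1 (hV.eq_zero_of_card_le hi' fun j hj => ?_))
    have hj' : j ∈ S i' := hSS ▸ hj
    simp only [S, Finset.mem_filter, Finset.mem_univ, true_and] at hj hj'
    simp only [Pi.sub_apply, mul_sub, Finset.sum_sub_distrib, hfc, hj, hj', sub_self]
  have hsplit : ∑ i ∈ I, (S i).card + ∑ i ∈ Iᶜ, (S i).card = ∑ i, (S i).card :=
    Finset.sum_add_sum_compl I _
  have hcard : I.card + Iᶜ.card = m + 1 := by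
    rw [Finset.card_add_card_compl, Fintype.card_fin]
  have hsmall : ∑ i ∈ Iᶜ, (S i).card + Iᶜ.card ≤ Iᶜ.card * k := by
    rw [← smul_eq_mul, ← Finset.sum_const, Finset.card_eq_sum_ones, ← Finset.sum_add_distrib]
    refine Finset.sum_le_sum fun i hi => ?_
    have : ¬ k ≤ (S i).card := by simpa [I] using hi
    omega
  have hI1 : I.card ≤ 1 := by
    have hST : ∀ A ∈ I.image S, ∃ i ∈ I, S i = A := fun A hA => Finset.mem_image.1 hA
    choose! g hgI hgS using hST
    have := hV'.card_le_one_of_agree (I.image S) (fun A => f (g A)) y ?_ ?_ ?_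
    · rwa [Finset.card_image_of_injOn hSinj] at this
    · intro A hA j hj
      rw [hfc]
      rw [← hgS A hA] at hj
      simpa [S] using hj
    · intro A hA B hB h
      rw [← hgS A hA, ← hgS B hB, hfinj h]
    · rw [Finset.card_image_of_injOn hSinj, Finset.sum_image hSinj]
      nlinarith
  have hIn : ∑ i ∈ I, (S i).card ≤ I.card * n := by
    rw [← smul_eq_mul, ← Finset.sum_const]
    exact Finset.sum_le_sum fun i _ => (Finset.card_le_univ _).trans_eq (Fintype.card_fin n)
  rcases (show I.card = 0 ∨ I.card = 1 by omega) with h0 | h1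
  · have h2 : Iᶜ.card = m + 1 := by omega
    rw [h2] at hsmall
    rw [h0] at hIn
    nlinarith
  · have h2 : Iᶜ.card = m := by omega
    rw [h2] at hsmall
    rw [h1] at hIn
    nlinarith

end Code

/-! ### Intersections of column spans -/

section ColumnSpans
variable {F : Type*} [Field F] {m n : ℕ}

/-- The linear relations among the columns of `G` indexed by `A`. -/
def suppKer (G : Matrix (Fin m) (Fin n) F) (A : Finset (Fin n)) : Submodule F (Fin n → F) where
  carrier := {y | (∀ j ∉ A, y j = 0) ∧ G.mulVec y = 0}
  add_mem' := by
    rintro y z ⟨h1, h2⟩ ⟨h3, h4⟩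
    exact ⟨fun j hj => by simp [h1 j hj, h3 j hj], by rw [Matrix.mulVec_add, h2, h4, add_zero]⟩
  zero_mem' := by simp
  smul_mem' := by
    rintro t y ⟨h1, h2⟩
    exact ⟨fun j hj => by simp [h1 j hj], by rw [Matrix.mulVec_smul, h2, smul_zero]⟩

theorem mem_colSpan {G : Matrix (Fin m) (Fin n) F} {A : Finset (Fin n)} {w : Fin m → F} :
    w ∈ colSpan G A ↔ ∃ y : Fin n → F, (∀ j ∉ A, y j = 0) ∧ G.mulVec y = w := by
  constructor
  · intro hw
    induction hw using Submodule.span_induction with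
    | mem w hw =>
      obtain ⟨j, hj, rfl⟩ := hw
      refine ⟨Pi.single j 1, fun j' hj' => Pi.single_eq_of_ne ?_ _, ?_⟩
      · rintro rfl
        exact hj' hj
      · rw [Matrix.mulVec_single_one]; rfl
    | zero => exact ⟨0, fun _ _ => rfl, Matrix.mulVec_zero G⟩
    | add w w' _ _ h h' =>
      obtain ⟨y, h1, rfl⟩ := h
      obtain ⟨y', h1', rfl⟩ := h'
      exact ⟨y + y', fun j hj => by simp [h1 j hj, h1' j hj], Matrix.mulVec_add _ _ _⟩
    | smul t w _ h =>
      obtain ⟨y, h1, rfl⟩ := h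
      exact ⟨t • y, fun j hj => by simp [h1 j hj], Matrix.mulVec_smul _ _ _⟩
  · rintro ⟨y, hy, rfl⟩
    rw [Matrix.mulVec_eq_sum]
    refine Submodule.sum_mem _ fun j _ => ?_
    by_cases hj : j ∈ A
    · have : G.transpose j ∈ colSpan G A := Submodule.subset_span ⟨j, hj, rfl⟩
      rw [op_smul_eq_smul]
      exact Submodule.smul_mem _ _ this
    · rw [hy j hj]; simp

theorem colSpan_mono (G : Matrix (Fin m) (Fin n) F) {A B : Finset (Fin n)} (h : A ⊆ B) :
    colSpan G A ≤ colSpan G B :=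
  Submodule.span_mono (Set.image_mono (by exact_mod_cast h))

theorem finrank_suppKer_add_finrank_colSpan (G : Matrix (Fin m) (Fin n) F) (A : Finset (Fin n)) :
    finrank F (suppKer G A) + finrank F (colSpan G A) = A.card := by
  classical
  let ext0 : (A → F) →ₗ[F] (Fin n → F) :=
    { toFun := fun y j => if h : j ∈ A then y ⟨j, h⟩ else 0
      map_add' := fun y z => by ext j; by_cases h : j ∈ A <;> simp [h]
      map_smul' := fun t y => by ext j; by_cases h : j ∈ A <;> simp [h] }
  have hin : ∀ y j (h : j ∈ A), ext0 y j = y ⟨j, h⟩ := fun y j h => dif_pos h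
  have hout : ∀ y j, j ∉ A → ext0 y j = 0 := fun y j h => dif_neg h
  have hinj : Function.Injective ext0 := fun y z h => funext fun j => by
    have := congrFun h j.1
    rwa [hin y _ j.2, hin z _ j.2] at this
  have hsurj : ∀ y : Fin n → F, (∀ j ∉ A, y j = 0) → ext0 (fun j => y j.1) = y := by
    intro y hy
    ext j
    by_cases h : j ∈ A
    · rw [hin _ _ h]
    · rw [hout _ _ h, hy j h]
  have h1 := LinearMap.finrank_range_add_finrank_ker (G.mulVecLin ∘ₗ ext0)
  have h2 : LinearMap.range (G.mulVecLin ∘ₗ ext0) = colSpan G A := by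
    ext w
    rw [mem_colSpan, LinearMap.mem_range]
    constructor
    · rintro ⟨y, rfl⟩
      exact ⟨ext0 y, hout y, rfl⟩
    · rintro ⟨y, hy, rfl⟩
      exact ⟨fun j => y j.1, by rw [LinearMap.comp_apply, hsurj y hy]; rfl⟩
  have h3 : (LinearMap.ker (G.mulVecLin ∘ₗ ext0)).map ext0 = suppKer G A := by
    ext y
    rw [Submodule.mem_map]
    constructor
    · rintro ⟨z, hz, rfl⟩
      exact ⟨hout z, hz⟩
    · rintro ⟨hy, hy'⟩
      refine ⟨fun j => y j.1, ?_, hsurj y hy⟩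
      rw [LinearMap.mem_ker, LinearMap.comp_apply, hsurj y hy]
      exact hy'
  rw [h2, (Submodule.equivMapOfInjective ext0 hinj _).finrank_eq, h3, finrank_fintype_fun_eq_card,
    Fintype.card_coe] at h1
  omega

/-- Families `(y_A)_{A ∈ T}` with `y_A` supported on `A` and `G y_A` independent of `A`, extended
by zero to all `A`. -/
def coincidenceSpace (G : Matrix (Fin m) (Fin n) F) (T : Finset (Finset (Fin n))) :
    Submodule F (Finset (Fin n) × Fin n → F) where
  carrier := {y | (∀ A j, A ∉ T ∨ j ∉ A → y (A, j) = 0) ∧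
    ∀ A ∈ T, ∀ B ∈ T, G.mulVec (fun j => y (A, j)) = G.mulVec fun j => y (B, j)}
  add_mem' := by
    rintro y z ⟨h1, h2⟩ ⟨h3, h4⟩
    refine ⟨fun A j h => by simp [h1 A j h, h3 A j h], fun A hA B hB => ?_⟩
    have e : ∀ A, (fun j => (y + z) (A, j)) = (fun j => y (A, j)) + fun j => z (A, j) :=
      fun A => rfl
    rw [e, e, Matrix.mulVec_add, Matrix.mulVec_add, h2 A hA B hB, h4 A hA B hB]
  zero_mem' := ⟨fun _ _ _ => rfl, fun _ _ _ _ => rfl⟩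
  smul_mem' := by
    rintro t y ⟨h1, h2⟩
    refine ⟨fun A j h => by simp [h1 A j h], fun A hA B hB => ?_⟩
    have e : ∀ A, (fun j => (t • y) (A, j)) = t • fun j => y (A, j) := fun A => rfl
    rw [e, e, Matrix.mulVec_smul, Matrix.mulVec_smul, h2 A hA B hB]

/-- The linear forms that cut out `coincidenceSpace`, over a ring that can be specialized. -/
def coincidenceForms {R : Type*} [CommRing R] (G : Matrix (Fin m) (Fin n) R)
    (T : Finset (Finset (Fin n))) : Set (Finset (Fin n) × Fin n → R) :=
  {l | ∃ A j, (A ∉ T ∨ j ∉ A) ∧ l = Pi.single (A, j) 1} ∪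
  {l | ∃ A ∈ T, ∃ B ∈ T, ∃ i, l = ∑ j, G i j • (Pi.single (A, j) 1 - Pi.single (B, j) 1)}

/-- The common value `G y_A` ranges over the intersection of the column spans. -/
theorem finrank_coincidenceSpace (G : Matrix (Fin m) (Fin n) F) {T : Finset (Finset (Fin n))}
    (hT : T.Nonempty) : finrank F (coincidenceSpace G T) =
      finrank F (⨅ A ∈ T, colSpan G A : Submodule F (Fin m → F)) +
        ∑ A ∈ T, finrank F (suppKer G A) := by
  classical
  obtain ⟨A₀, hA₀⟩ := hT
  let π : coincidenceSpace G T →ₗ[F] (Fin m → F) :=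
    { toFun := fun y => G.mulVec fun j => y.1 (A₀, j)
      map_add' := fun y z => Matrix.mulVec_add _ _ _
      map_smul' := fun t y => Matrix.mulVec_smul _ _ _ }
  have hrange : LinearMap.range π = ⨅ A ∈ T, colSpan G A := by
    ext w
    simp only [LinearMap.mem_range, Submodule.mem_iInf, mem_colSpan]
    constructor
    · rintro ⟨y, rfl⟩ A hA
      exact ⟨fun j => y.1 (A, j), fun j hj => y.2.1 A j (Or.inr hj), y.2.2 A hA A₀ hA₀⟩
    · intro h
      choose y hy hyw using h
      refine ⟨⟨fun p => if hp : p.1 ∈ T then y p.1 hp p.2 else 0, fun A j h => ?_,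
        fun A hA B hB => ?_⟩, ?_⟩
      · by_cases hA : A ∈ T
        · simpa [hA] using hy A hA j (h.resolve_left (not_not.2 hA))
        · simp [hA]
      · simp only [hA, hB, dif_pos]
        exact (hyw A hA).trans (hyw B hB).symm
      · simp only [π, LinearMap.coe_mk, AddHom.coe_mk, hA₀, dif_pos]
        exact hyw A₀ hA₀
  let κ : LinearMap.ker π ≃ₗ[F] (∀ A : T, suppKer G A.1) :=
    { toFun := fun y A => ⟨fun j => y.1.1 (A.1, j), fun j hj => y.1.2.1 A.1 j (Or.inr hj),
        (y.1.2.2 A.1 A.2 A₀ hA₀).trans y.2⟩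
      map_add' := fun y z => rfl
      map_smul' := fun t y => rfl
      invFun := fun z => ⟨⟨fun p => if hp : p.1 ∈ T then (z ⟨p.1, hp⟩).1 p.2 else 0,
        fun A j h => by
          by_cases hA : A ∈ T
          · simpa [hA] using (z ⟨A, hA⟩).2.1 j (h.resolve_left (not_not.2 hA))
          · simp [hA],
        fun A hA B hB => by
          simp only [hA, hB, dif_pos]
          exact (z ⟨A, hA⟩).2.2.trans (z ⟨B, hB⟩).2.2.symm⟩, by
          simp only [π, LinearMap.mem_ker, LinearMap.coe_mk, AddHom.coe_mk, hA₀, dif_pos]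
          exact (z ⟨A₀, hA₀⟩).2.2⟩
      left_inv := fun y => by
        ext ⟨A, j⟩
        by_cases hA : A ∈ T
        · simp [hA]
        · simpa [hA] using (y.1.2.1 A j (Or.inl hA)).symm
      right_inv := fun z => by
        ext A j
        simp }
  have h1 := LinearMap.finrank_range_add_finrank_ker π
  rw [hrange, κ.finrank_eq, finrank_pi_fintype, Finset.sum_coe_sort T
    (fun A => finrank F (suppKer G A))] at h1
  exact h1.symm

theorem solutionSpace_coincidenceForms {R : Type*} [CommRing R] (φ : R →+* F)
    (G : Matrix (Fin m) (Fin n) R) (T : Finset (Finset (Fin n))) :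
    solutionSpace φ (coincidenceForms G T) = coincidenceSpace (G.map φ) T := by
  have hs := sum_map_single_mul (c := Finset (Fin n) × Fin n) φ
  have he : ∀ (y : Finset (Fin n) × Fin n → F) (A B : Finset (Fin n)) (i : Fin m),
      ∑ p, φ ((∑ j, G i j • (Pi.single (A, j) 1 - Pi.single (B, j) 1) :
        Finset (Fin n) × Fin n → R) p) * y p =
        (G.map φ).mulVec (fun j => y (A, j)) i - (G.map φ).mulVec (fun j => y (B, j)) i :=
    fun y A B i => sum_map_sum_smul_single_sub_single_mul φ y _ _ _
  ext y
  rw [mem_solutionSpace]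
  constructor
  · intro h
    refine ⟨fun A j hA => ?_, fun A hA B hB => funext fun i => ?_⟩
    · rw [← hs y (A, j)]
      exact h _ (Or.inl ⟨A, j, hA, rfl⟩)
    · rw [← sub_eq_zero]
      exact (he y A B i).symm.trans (h _ (Or.inr ⟨A, hA, B, hB, i, rfl⟩))
  · rintro ⟨h1, h2⟩ l (⟨A, j, hA, rfl⟩ | ⟨A, hA, B, hB, i, rfl⟩)
    · rw [hs, h1 A j hA]
    · rw [he, h2 A hA B hB, sub_self]

theorem sum_finrank_le_finrank_iInf {τ M : Type*} [AddCommGroup M] [Module F M]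
    [FiniteDimensional F M] (S : Finset τ) (U : τ → Submodule F M) :
    ∑ b ∈ S, finrank F (U b) + finrank F M ≤
      finrank F (⨅ b ∈ S, U b : Submodule F M) + S.card * finrank F M := by
  classical
  induction S using Finset.induction_on with
  | empty =>
    have : (⨅ b ∈ (∅ : Finset τ), U b) = ⊤ := by simp
    rw [this, finrank_top]
    simp
  | insert b S hb ih =>
    rw [Finset.sum_insert hb, Finset.card_insert_of_notMem hb, Finset.iInf_insert]
    have h1 := Submodule.finrank_sup_add_finrank_inf_eq (U b) (⨅ b ∈ S, U b)
    have h2 := Submodule.finrank_le (U b ⊔ ⨅ b ∈ S, U b)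
    rw [add_mul, one_mul]
    omega

end ColumnSpans

/-! ### Dual matrices -/

section Dual
variable {F : Type*} [Field F] {m n k : ℕ}

/-- The relations on `A` are a coincidence space, the common value being forced to be `0`. Hence
semicontinuity for coincidence spaces also covers `suppKer`. -/
theorem finrank_coincidenceSpace_pair_empty (G : Matrix (Fin m) (Fin n) F) (A : Finset (Fin n)) :
    finrank F (coincidenceSpace G {A, ∅}) = finrank F (suppKer G A) := by
  rw [finrank_coincidenceSpace G (Finset.insert_nonempty _ _)]
  have h1 : colSpan G ∅ = ⊥ := by simp [colSpan]
  have h2 : (⨅ B ∈ ({A, ∅} : Finset (Finset (Fin n))), colSpan G B) = ⊥ := by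
    refine eq_bot_iff.2 ((iInf₂_le ∅ ?_).trans h1.le)
    simp
  have h3 : finrank F (suppKer G ∅) = 0 := by
    have := finrank_suppKer_add_finrank_colSpan G ∅
    rw [Finset.card_empty] at this
    omega
  rw [h2, finrank_bot, zero_add]
  by_cases hA : A = ∅
  · subst hA; simp
  · rw [Finset.sum_pair hA, h3, add_zero]

/-- The matrix `G` is a specialization of the generic matrix. -/
theorem finrank_coincidenceSpace_genericMatrix_le (G : Matrix (Fin m) (Fin n) F)
    (T : Finset (Finset (Fin n))) :
    finrank (FractionRing (MvPolynomial (Fin m × Fin n) F))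
      (coincidenceSpace (genericMatrix F m n) T) ≤ finrank F (coincidenceSpace G T) := by
  let X : Matrix (Fin m) (Fin n) (MvPolynomial (Fin m × Fin n) F) :=
    Matrix.of fun i j => MvPolynomial.X (i, j)
  let φ : MvPolynomial (Fin m × Fin n) F →+* F := MvPolynomial.eval fun p => G p.1 p.2
  obtain ⟨P, hP, hle⟩ := exists_ne_zero_finrank_solutionSpace_le φ (coincidenceForms X T)
  have hψ : algebraMap _ (FractionRing (MvPolynomial (Fin m × Fin n) F)) P ≠ 0 := by
    rw [Ne, IsFractionRing.to_map_eq_zero_iff]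
    rintro rfl
    exact hP (map_zero φ)
  have := hle (algebraMap _ (FractionRing (MvPolynomial (Fin m × Fin n) F))) hψ
  rw [solutionSpace_coincidenceForms, solutionSpace_coincidenceForms] at this
  have hX : X.map φ = G := by
    ext i j
    simp [X, φ]
  rw [hX] at this
  exact this

variable {V : Matrix (Fin k) (Fin n) F} {Q : Matrix (Fin (n - k)) (Fin n) F}

/-- The kernel of a dual matrix is the code. -/
theorem IsDualMatrix.mulVec_eq_zero_iff (hQ : IsDualMatrix V Q) (hV : V.rank = k) (hkn : k ≤ n)
    {y : Fin n → F} : Q.mulVec y = 0 ↔ ∃ x, V.transpose.mulVec x = y := by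
  have hle : LinearMap.range V.transpose.mulVecLin ≤ LinearMap.ker Q.mulVecLin := by
    rintro _ ⟨x, rfl⟩
    rw [LinearMap.mem_ker, ← LinearMap.comp_apply, ← Matrix.mulVecLin_mul]
    have : Q * V.transpose = 0 := by
      ext j i
      rw [Matrix.mul_apply, Matrix.zero_apply, ← hQ.2 i j]
      exact Finset.sum_congr rfl fun t _ => mul_comm _ _
    rw [this]
    simp
  have h1 := LinearMap.finrank_range_add_finrank_ker Q.mulVecLin
  have h2 : finrank F (LinearMap.range Q.mulVecLin) = n - k := hQ.1
  have h3 : finrank F (LinearMap.range V.transpose.mulVecLin) = k :=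
    (Matrix.rank_transpose V).trans hV
  rw [h2, finrank_fintype_fun_eq_card, Fintype.card_fin] at h1
  have heq := Submodule.eq_of_le_of_finrank_eq hle (by omega)
  have : y ∈ LinearMap.range V.transpose.mulVecLin ↔ y ∈ LinearMap.ker Q.mulVecLin := by rw [heq]
  exact this.symm

theorem IsDualMatrix.finrank_suppKer_le (hQ : IsDualMatrix V Q) (hkn : k ≤ n)
    (hV : InGeneralPosition Bool V) (A : Finset (Fin n)) :
    finrank F (suppKer Q A) ≤ A.card - (n - k) := by
  have hrank := rank_of_inGeneralPosition hkn hV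
  have hAc : A.card + Aᶜ.card = n := by rw [Finset.card_add_card_compl, Fintype.card_fin]
  -- a set of `#A - (n - k)` coordinates of `A` on which a codeword supported on `A` is determined
  obtain ⟨S, hSA, hS⟩ := Finset.exists_subset_card_eq
    (show A.card - (n - k) ≤ A.card from Nat.sub_le _ _)
  let ρ : suppKer Q A →ₗ[F] (S → F) :=
    { toFun := fun y j => y.1 j.1
      map_add' := fun _ _ => rfl
      map_smul' := fun _ _ => rfl }
  have hρ : Function.Injective ρ := by
    intro y z hyz
    obtain ⟨x, hx⟩ := (hQ.mulVec_eq_zero_iff hrank hkn).1 y.2.2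
    obtain ⟨x', hx'⟩ := (hQ.mulVec_eq_zero_iff hrank hkn).1 z.2.2
    have hk : k ≤ (S ∪ Aᶜ).card := by
      rw [Finset.card_union_of_disjoint
        (Finset.disjoint_left.2 fun j hj hj' => Finset.mem_compl.1 hj' (hSA hj))]
      omega
    have : x - x' = 0 := hV.eq_zero_of_card_le hk fun j hj => by
      have e1 : ∑ i, V i j * x i = y.1 j := congrFun hx j
      have e2 : ∑ i, V i j * x' i = z.1 j := congrFun hx' j
      simp only [Pi.sub_apply, mul_sub, Finset.sum_sub_distrib]
      rw [e1, e2, sub_eq_zero]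
      rcases Finset.mem_union.1 hj with h | h
      · exact congrFun hyz ⟨j, h⟩
      · rw [y.2.1 j (Finset.mem_compl.1 h), z.2.1 j (Finset.mem_compl.1 h)]
    exact Subtype.ext (by rw [← hx, ← hx', sub_eq_zero.1 this])
  have := LinearMap.finrank_le_finrank_of_injective hρ
  rwa [finrank_fintype_fun_eq_card, Fintype.card_coe, hS] at this

/-- The differences `y_{A₀} - y_A` are codewords, whose coefficient vectors form an agreeing
family: if `j ∉ A` and `j ∉ B`, then `y_A` and `y_B` both vanish at `j`. Such families may be
shifted by a constant, and the only further freedom is `y_{A₀}` on the intersection of all `A`. -/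
theorem IsDualMatrix.finrank_coincidenceSpace_add_le (hQ : IsDualMatrix V Q) (hkn : k ≤ n)
    (hV : InGeneralPosition Bool V) {T : Finset (Finset (Fin n))} (hT : T.Nonempty) :
    finrank F (coincidenceSpace Q T) + k ≤
      finrank F (agreeSpace V T (fun j => Finset.univ.filter fun A => j ∉ A) 0) +
        (Finset.univ.filter fun j => ∀ A ∈ T, j ∈ A).card := by
  classical
  have hrank := rank_of_inGeneralPosition hkn hV
  obtain ⟨A₀, hA₀⟩ := hT
  set Z : Finset (Fin n) := Finset.univ.filter fun j => ∀ A ∈ T, j ∈ A with hZ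
  have hinj : LinearMap.ker V.transpose.mulVecLin = ⊥ := by
    rw [LinearMap.ker_eq_bot']
    intro x hx
    exact hV.eq_zero_of_card_le (S := Finset.univ) (by simpa) fun j _ => congrFun hx j
  obtain ⟨s, hs⟩ := V.transpose.mulVecLin.exists_leftInverse_of_injective hinj
  have hs' : ∀ y, Q.mulVec y = 0 → ∀ j, ∑ i, V i j * s y i = y j := by
    intro y hy j
    obtain ⟨x, rfl⟩ := (hQ.mulVec_eq_zero_iff hrank hkn).1 hy
    have : s (V.transpose.mulVec x) = x := LinearMap.congr_fun hs x
    rw [this]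
    rfl
  let δ : Finset (Fin n) → coincidenceSpace Q T →ₗ[F] (Fin n → F) := fun A =>
    { toFun := fun y j => y.1 (A₀, j) - y.1 (A, j)
      map_add' := fun y z => by ext j; simp; ring
      map_smul' := fun t y => by ext j; simp; ring }
  have hδ : ∀ A ∈ T, ∀ y, Q.mulVec (δ A y) = 0 := by
    intro A hA y
    have : δ A y = (fun j => y.1 (A₀, j)) - fun j => y.1 (A, j) := rfl
    rw [this, Matrix.mulVec_sub, y.2.2 A₀ hA₀ A hA, sub_self]
  -- the linear map `s` recovers coefficient vectors from codewords; `p.2` is the constant shift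
  let Θ : (coincidenceSpace Q T × (Fin k → F)) →ₗ[F]
      (agreeSpace V T (fun j => Finset.univ.filter fun A => j ∉ A) 0 × (Z → F)) :=
    { toFun := fun p => ⟨⟨fun q => if q.1 ∈ T then p.2 q.2 + s (δ q.1 p.1) q.2 else 0, by
          have hval : ∀ A ∈ T, ∀ j, ∑ i, V i j * (if (A, i).1 ∈ T then
              p.2 (A, i).2 + s (δ (A, i).1 p.1) (A, i).2 else 0) =
              ∑ i, V i j * p.2 i + (p.1.1 (A₀, j) - p.1.1 (A, j)) := by
            intro A hA j
            simp only [if_pos hA, mul_add, Finset.sum_add_distrib]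
            rw [hs' _ (hδ A hA p.1)]
            rfl
          refine ⟨fun A i hA => if_neg hA, fun j A hA B hB hjA hjB => ?_, fun i _ _ _ _ h _ => ?_⟩
          · rw [hval A hA, hval B hB, p.1.2.1 A j (Or.inr (Finset.mem_filter.1 hjA).2),
              p.1.2.1 B j (Or.inr (Finset.mem_filter.1 hjB).2)]
          · have := i.2
            simp at h
            omega⟩, fun j => p.1.1 (A₀, j.1)⟩
      map_add' := fun p p' => by
        ext q
        · by_cases hq : q.1 ∈ T
          · simp [hq]; ring
          · simp [hq]
        · simp
      map_smul' := fun t p => by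
        ext q
        · by_cases hq : q.1 ∈ T
          · simp [hq]; ring
          · simp [hq]
        · simp }
  have hΘ : Function.Injective Θ := by
    rw [← LinearMap.ker_eq_bot, LinearMap.ker_eq_bot']
    rintro ⟨y, x⟩ h
    have h1 : ∀ A ∈ T, ∀ i, x i + s (δ A y) i = 0 := by
      intro A hA i
      have := congrFun (congrArg Subtype.val (congrArg Prod.fst h)) (A, i)
      simpa [Θ, hA] using this
    have h2 : ∀ j ∈ Z, y.1 (A₀, j) = 0 := fun j hj =>
      congrFun (congrArg Prod.snd h) ⟨j, hj⟩
    have hx : x = 0 := by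
      have h0 : δ A₀ y = 0 := funext fun j => sub_self _
      ext i
      have := h1 A₀ hA₀ i
      rw [h0, map_zero] at this
      simpa using this
    have hy : ∀ A ∈ T, ∀ j, y.1 (A₀, j) = y.1 (A, j) := by
      intro A hA j
      have h0 : s (δ A y) = 0 := funext fun i => by
        have := h1 A hA i
        rw [hx] at this
        simpa using this
      have := hs' _ (hδ A hA y) j
      rw [h0] at this
      simp only [Pi.zero_apply, mul_zero, Finset.sum_const_zero] at this
      exact sub_eq_zero.1 this.symm
    have hy0 : ∀ j, y.1 (A₀, j) = 0 := by
      intro j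
      by_cases hj : j ∈ Z
      · exact h2 j hj
      · have : ∃ A ∈ T, j ∉ A := by simpa [hZ] using hj
        obtain ⟨A, hA, hjA⟩ := this
        rw [hy A hA, y.2.1 A j (Or.inr hjA)]
    refine Prod.ext (Subtype.ext (funext fun p => ?_)) hx
    by_cases hp : p.1 ∈ T
    · exact (hy p.1 hp p.2).symm.trans (hy0 p.2)
    · exact y.2.1 p.1 p.2 (Or.inl hp)
  have := LinearMap.finrank_le_finrank_of_injective hΘ
  rwa [finrank_prod, finrank_prod, finrank_fintype_fun_eq_card, finrank_fintype_fun_eq_card,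
    Fintype.card_fin, Fintype.card_coe] at this

end Dual

theorem iInf_eq_iInf_image {κ β R : Type*} [Fintype κ] [DecidableEq β] [CompleteLattice R]
    (A : κ → β) (f : β → R) : ⨅ i, f (A i) = ⨅ B ∈ Finset.univ.image A, f B := by
  rw [Finset.iInf_finset_image]
  simp

theorem card_sub_le_finrank_suppKer {Ω : Type*} [Field Ω] {m n : ℕ}
    (W : Matrix (Fin m) (Fin n) Ω) (B : Finset (Fin n)) :
    B.card - m ≤ finrank Ω (suppKer W B) := by
  have h1 := finrank_suppKer_add_finrank_colSpan W B
  have h2 := Submodule.finrank_le (colSpan W B)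
  rw [finrank_fintype_fun_eq_card, Fintype.card_fin] at h2
  omega

/-- The intersection of the members of `T` in the fibre of `r` over `b`. -/
def blockInter {n : ℕ} {β : Type*} [DecidableEq β] (T : Finset (Finset (Fin n)))
    (r : Finset (Fin n) → β) (b : β) : Finset (Fin n) :=
  Finset.univ.filter fun j => ∀ B ∈ T, r B = b → j ∈ B

theorem blockInter_subset {n : ℕ} {β : Type*} [DecidableEq β] {T : Finset (Finset (Fin n))}
    (r : Finset (Fin n) → β) {B : Finset (Fin n)} (hB : B ∈ T) : blockInter T r (r B) ⊆ B :=
  fun _ hj => (Finset.mem_filter.1 hj).2 B hB rfl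

/-- The lower bound for the intersection of column spans given by a partition of `T`: the members
of each block may be replaced by their intersection. -/
theorem sum_card_blockInter_le {Ω β : Type*} [Field Ω] [DecidableEq β] {m n : ℕ}
    {W : Matrix (Fin m) (Fin n) Ω}
    (hW : ∀ B : Finset (Fin n), finrank Ω (suppKer W B) = B.card - m)
    (T : Finset (Finset (Fin n))) (r : Finset (Fin n) → β) :
    ∑ b ∈ T.image r, (blockInter T r b).card + m ≤
      finrank Ω (⨅ B ∈ T, colSpan W B : Submodule Ω (Fin m → Ω)) + ∑ B ∈ T, (B.card - m) +
        (T.image r).card * m := by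
  classical
  have hlow := sum_finrank_le_finrank_iInf (T.image r) fun b => colSpan W (blockInter T r b)
  rw [finrank_fintype_fun_eq_card, Fintype.card_fin] at hlow
  have hmono : finrank Ω (⨅ b ∈ T.image r, colSpan W (blockInter T r b) :
      Submodule Ω (Fin m → Ω)) ≤ finrank Ω (⨅ B ∈ T, colSpan W B : Submodule Ω (Fin m → Ω)) :=
    Submodule.finrank_mono <| le_iInf₂ fun B hB =>
      (iInf₂_le (r B) (Finset.mem_image_of_mem r hB)).trans
        (colSpan_mono W (blockInter_subset r hB))
  have hdef : ∑ b ∈ T.image r, ((blockInter T r b).card - m) ≤ ∑ B ∈ T, (B.card - m) := by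
    rw [← Finset.sum_fiberwise_of_maps_to (t := T.image r) (g := r)
      (fun B hB => Finset.mem_image_of_mem r hB)]
    refine Finset.sum_le_sum fun b hb => ?_
    obtain ⟨B, hB, rfl⟩ := Finset.mem_image.1 hb
    exact (Nat.sub_le_sub_right (Finset.card_le_card (blockInter_subset r hB)) _).trans
      (Finset.single_le_sum (f := fun B : Finset (Fin n) => B.card - m)
        (fun _ _ => Nat.zero_le _) (Finset.mem_filter.2 ⟨hB, rfl⟩))
  have hdim : ∑ b ∈ T.image r, (blockInter T r b).card =
      ∑ b ∈ T.image r, finrank Ω (colSpan W (blockInter T r b)) +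
        ∑ b ∈ T.image r, ((blockInter T r b).card - m) := by
    rw [← Finset.sum_add_distrib]
    refine Finset.sum_congr rfl fun b _ => ?_
    rw [← hW, add_comm, finrank_suppKer_add_finrank_colSpan]
  omega

/-- Both `Q` and the generic matrix have column spans of dimension `min #A (n - k)`. This gives a
lower bound for the intersection over a partition of `T`, which `exists_blocks` shows to be an
upper bound for `Q`; semicontinuity gives the remaining inequality. -/
theorem IsDualMatrix.isMDS {F : Type*} [Field F] {n k : ℕ} {V : Matrix (Fin k) (Fin n) F}
    {Q : Matrix (Fin (n - k)) (Fin n) F} (hQ : IsDualMatrix V Q) (hkn : k ≤ n)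
    (hV : InGeneralPosition Bool V) (hV' : InGeneralPosition (Finset (Fin n)) V) (L : ℕ) :
    IsMDS (L + 1) Q := by
  classical
  intro A
  set W := genericMatrix F (n - k) n with hW
  rw [iInf_eq_iInf_image, iInf_eq_iInf_image]
  set T := Finset.univ.image A with hTdef
  have hT : T.Nonempty := Finset.univ_nonempty.image A
  -- dimensions of the spaces of relations
  have hQle := hQ.finrank_suppKer_le hkn hV
  have hWQ : ∀ B, finrank _ (suppKer W B) ≤ finrank F (suppKer Q B) := fun B => by
    rw [← finrank_coincidenceSpace_pair_empty, ← finrank_coincidenceSpace_pair_empty]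
    exact finrank_coincidenceSpace_genericMatrix_le Q _
  have hWge := card_sub_le_finrank_suppKer W
  have hWeq : ∀ B : Finset (Fin n), finrank _ (suppKer W B) = B.card - (n - k) := fun B =>
    le_antisymm ((hWQ B).trans (hQle B)) (hWge B)
  have hQeq : ∀ B : Finset (Fin n), finrank F (suppKer Q B) = B.card - (n - k) := fun B =>
    le_antisymm (hQle B) ((hWge B).trans (hWQ B))
  have hNQ := finrank_coincidenceSpace Q hT
  have hNW := finrank_coincidenceSpace W hT
  have hNWQ := finrank_coincidenceSpace_genericMatrix_le Q T
  rw [Finset.sum_congr rfl fun B _ => hQeq B] at hNQ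
  rw [Finset.sum_congr rfl fun B _ => hWeq B] at hNW
  refine le_antisymm ?_ (by rw [← hW] at hNWQ; omega)
  -- both intersections are compared with a count over the blocks of the partition
  have hagree := hQ.finrank_coincidenceSpace_add_le hkn hV hT
  set E : Fin n → Finset (Finset (Fin n)) := fun j => Finset.univ.filter fun A => j ∉ A with hE
  obtain ⟨r, -, hr⟩ := hV'.exists_blocks T E
  set 𝓑 := T.image r with h𝓑
  set inter := blockInter T r with hinter
  set Z : Finset (Fin n) := Finset.univ.filter fun j => ∀ A ∈ T, j ∈ A with hZ
  have himg : ∀ j, (E j ∩ T).image r = 𝓑.filter fun b => j ∉ inter b := by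
    intro j
    ext b
    simp only [Finset.mem_image, Finset.mem_inter, Finset.mem_filter, h𝓑, hE, hinter, blockInter,
      Finset.mem_univ, true_and, not_forall]
    constructor
    · rintro ⟨B, ⟨hj, hB⟩, rfl⟩
      exact ⟨⟨B, hB, rfl⟩, B, hB, rfl, hj⟩
    · rintro ⟨-, B, hB, hb, hj⟩
      exact ⟨B, ⟨hj, hB⟩, hb⟩
  have hcount : ∑ j, ((E j ∩ T).image r).card + ∑ b ∈ 𝓑, (inter b).card = 𝓑.card * n := by
    have h1 := Finset.sum_card_bipartiteAbove_eq_sum_card_bipartiteBelow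
      (s := (Finset.univ : Finset (Fin n))) (t := 𝓑) (fun j b => j ∉ inter b)
    simp only [Finset.bipartiteAbove, Finset.bipartiteBelow] at h1
    rw [Finset.sum_congr rfl fun j _ => by rw [himg j], h1, ← Finset.sum_add_distrib,
      ← smul_eq_mul, ← Finset.sum_const]
    refine Finset.sum_congr rfl fun b _ => ?_
    have h2 := Finset.card_filter_add_card_filter_not (s := (Finset.univ : Finset (Fin n)))
      (fun j => j ∈ inter b)
    rw [Finset.card_univ, Fintype.card_fin, Finset.filter_mem_eq_inter, Finset.univ_inter] at h2
    omega
  have hcount' : ∑ j, ((E j ∩ T).image r).card + Z.card ≤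
      ∑ j, (((E j ∩ T).image r).card - 1) + n := by
    have h1 : ∀ j, ((E j ∩ T).image r).card + (if j ∈ Z then 1 else 0) ≤
        (((E j ∩ T).image r).card - 1) + 1 := by
      intro j
      split_ifs with hj
      · have : E j ∩ T = ∅ := by
          rw [Finset.eq_empty_iff_forall_notMem]
          intro B hB
          rw [Finset.mem_inter] at hB
          exact (Finset.mem_filter.1 hB.1).2 ((Finset.mem_filter.1 hj).2 B hB.2)
        simp [this]
      · omega
    have h2 := Finset.sum_le_sum fun j (_ : j ∈ Finset.univ) => h1 j
    rw [Finset.sum_add_distrib, Finset.sum_add_distrib] at h2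
    simpa using h2
  have hlow := sum_card_blockInter_le hWeq T r
  rw [← h𝓑, ← hinter] at hlow
  have hkn' : 𝓑.card * n = 𝓑.card * (n - k) + k * 𝓑.card := by
    rw [mul_comm k, ← mul_add, Nat.sub_add_cancel hkn]
  omega

/-- For points off a hypersurface that depends neither on the list size nor on the dual matrix,
all the conclusions hold. -/
theorem exists_generic_polynomial (F L : Type*) [Field F] [Field L] [Algebra F L]
    {k n : ℕ} (hkn : k ≤ n) {e : Fin k → ℤ} (he : StrictMono e) :
    ∃ P : MvPolynomial (Fin n) F, P ≠ 0 ∧ ∀ α : Fin n → L, MvPolynomial.aeval α P ≠ 0 →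
      (monomialMatrix e α).rank = k ∧ ∀ l : ℕ, IsLDMDS l (rowCode (monomialMatrix e α)) ∧
        ∀ Q : Matrix (Fin (n - k)) (Fin n) L, IsDualMatrix (monomialMatrix e α) Q →
          IsMDS (l + 1) Q := by
  obtain ⟨P₁, hP₁, h₁⟩ := exists_ne_zero_inGeneralPosition F L Bool (n := n) he
  obtain ⟨P₂, hP₂, h₂⟩ := exists_ne_zero_inGeneralPosition F L (Finset (Fin n)) (n := n) he
  refine ⟨P₁ * P₂, mul_ne_zero hP₁ hP₂, fun α hα => ?_⟩
  rw [map_mul] at hα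
  have g₁ := h₁ α (left_ne_zero_of_mul hα)
  have g₂ := h₂ α (right_ne_zero_of_mul hα)
  exact ⟨rank_of_inGeneralPosition hkn g₁, fun l => ⟨isLDMDS_of_inGeneralPosition hkn g₁ g₂ l,
    fun Q hQ => hQ.isMDS hkn g₁ g₂ l⟩⟩

end HigherOrderMDS

theorem mainTheorem4 {F : Type*} [Field F] {K : Type*} [Field K] [Algebra F K]
    (k n : ℕ) (hkn : k ≤ n) (e : Fin k → ℤ) (he : StrictMono e) :
    (∀ α : Fin n → K, AlgebraicIndependent F α →
      (HigherOrderMDS.monomialMatrix e α).rank = k ∧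
      ∀ L : ℕ, 2 ≤ L →
        HigherOrderMDS.IsLDMDS L
          (HigherOrderMDS.rowCode (HigherOrderMDS.monomialMatrix e α)) ∧
        ∀ Q : Matrix (Fin (n - k)) (Fin n) K,
          HigherOrderMDS.IsDualMatrix (HigherOrderMDS.monomialMatrix e α) Q →
            HigherOrderMDS.IsMDS (L + 1) Q) ∧
    (∃ P : MvPolynomial (Fin n) F, P ≠ 0 ∧
      ∀ α : Fin n → F, MvPolynomial.eval α P ≠ 0 →
        (HigherOrderMDS.monomialMatrix e α).rank = k ∧
        ∀ L : ℕ, 2 ≤ L →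
          HigherOrderMDS.IsLDMDS L
            (HigherOrderMDS.rowCode (HigherOrderMDS.monomialMatrix e α)) ∧
          ∀ Q : Matrix (Fin (n - k)) (Fin n) F,
            HigherOrderMDS.IsDualMatrix (HigherOrderMDS.monomialMatrix e α) Q →
              HigherOrderMDS.IsMDS (L + 1) Q) := by
  constructor
  · intro α hα
    obtain ⟨P, hP, h⟩ := HigherOrderMDS.exists_generic_polynomial F K hkn he
    have hPα : MvPolynomial.aeval α P ≠ 0 := fun h0 =>
      hP ((injective_iff_map_eq_zero _).1 hα P h0)
    exact ⟨(h α hPα).1, fun L _ => (h α hPα).2 L⟩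
  · obtain ⟨P, hP, h⟩ := HigherOrderMDS.exists_generic_polynomial F F hkn he
    refine ⟨P, hP, fun α hα => ?_⟩
    rw [← MvPolynomial.coe_aeval_eq_eval] at hα
    exact ⟨(h α hα).1, fun L _ => (h α hα).2 L⟩
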